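/- Let $\mathbb B^d$ be the set of nonoriented nearest neighbour bonds $\{x,y\}$ of $\mathbb Z^d$ ($|x-y|=1$). Each bond is uniquely of the form $\{x,x+e_i\}$. For $u:\mathbb Z^d\to\mathbb R$ set $\nabla u(\{x,x+e_i\}):=u(x+e_i)-u(x)$, and for $F:\mathbb B^d\to\mathbb R$ set $\nabla^*F(x):=\sum_{i=1}^d\bigl(F(\{x-e_i,x\})-F(\{x,x+e_i\})\bigr)$. For $n\in\mathbb N$ let $B(n):=([-n,n]\cap\mathbb Z)^d$. For a finite set $S\subset\mathbb Z^d$ and $r\in(0,\infty)$ let $\|u\|_{\underline L^r(S)}:=\bigl(\frac1{|S|}\sum_{x\in S}|u(x)|^r\bigr)^{1/r}$; for $F:\mathbb B^d\to\mathbb R$ let $\|F\|_{\underline L^r(S)}$ be the analogous normalized norm over the set of bonds both of whose end points lie in $S$; for $r=\infty$ these norms are the corresponding maxima. For $\omega:\mathbb B^d\to(0,\infty)$ and $p,q\in(1,\infty]$ put $$\Lambda^\omega(S):=\|\omega\|_{\underline L^p(S)}\,\|\omega^{-1}\|_{\underline L^q(S)} .$$ **Theorem.** Let $d\ge 3$ and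 let $p,q\in(1,\infty]$ satisfy $\frac1p+\frac1q<\frac2{d-1}$ (with $\frac1\infty=0$). Then $\delta:=\frac1{d-1}-\frac1{2p}-\frac1{2q}>0$, and there exists a constant $c=c(d,p,q)\in[1,\infty)$ such that for every $\omega:\mathbb B^d\to(0,\infty)$, every solution $u:\mathbb Z^d\to\mathbb R$ of $\nabla^*(\omega\nabla u)=0$ in $\mathbb Z^d$, and every integer $n\ge1$, $$\max_{x\in B(n)}|u(x)|\le c\,\Lambda^\omega(B(4n))^{\frac{\delta+1}{2\delta}}\,\|u\|_{\underline L^{2p'}(B(4n))},$$ where $p':=\frac p{p-1}$ (and $p'=1$ if $p=\infty$). -/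

import Mathlib

open scoped ENNReal

namespace RandomConductance

/-- The vertex set of the lattice `ℤ^d`. -/
abbrev Vertex (d : ℕ) : Type := Fin d → ℤ

/-- The nonoriented nearest neighbour bonds of `ℤ^d`. The pair `(x, i)` stands for the bond
`{x, x + e_i}`; every nearest neighbour pair is of this form for exactly one `(x, i)`, see
`bondEnds_injective` and `range_bondEnds`. -/
abbrev Bond (d : ℕ) : Type := Vertex d × Fin d

/-- The end point `x` of the bond `{x, x + e_i}`. -/
def lower {d : ℕ} (e : Bond d) : Vertex d := e.1

/-- The end point `x + e_i` of the bond `{x, x + e_i}`. -/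
def upper {d : ℕ} (e : Bond d) : Vertex d := e.1 + Pi.single e.2 1

/-- The unordered pair of end points of a bond. -/
def bondEnds {d : ℕ} (e : Bond d) : Sym2 (Vertex d) := s(lower e, upper e)

/-- Different indices `(x, i)` give different nonoriented bonds. -/
theorem bondEnds_injective {d : ℕ} : Function.Injective (bondEnds (d := d)) := by
  rintro ⟨x, i⟩ ⟨y, j⟩ h
  simp only [bondEnds, lower, upper, Sym2.eq_iff] at h
  rcases h with ⟨hx, hy⟩ | ⟨hx, hy⟩
  · subst hx
    have h1 := congrFun (add_left_cancel hy) i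
    by_cases hij : i = j
    · rw [hij]
    · rw [Pi.single_eq_same, Pi.single_eq_of_ne hij] at h1
      exact absurd h1 one_ne_zero
  · exfalso
    have h1 := congrFun hx j
    have h2 := congrFun hy j
    simp only [Pi.add_apply, Pi.single_eq_same] at h1 h2
    have h3 : (0 : ℤ) ≤ (Pi.single i 1 : Vertex d) j := by
      rw [Pi.single_apply]; split_ifs <;> norm_num
    omega

/-- The nonoriented bonds are exactly the pairs of vertices at Euclidean distance one. -/
theorem range_bondEnds {d : ℕ} :
    Set.range (bondEnds (d := d)) =
      {s : Sym2 (Vertex d) | ∃ x y : Vertex d, s = s(x, y) ∧ ∑ i, (x i - y i) ^ 2 = 1} := by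
  ext s
  constructor
  · rintro ⟨⟨x, i⟩, rfl⟩
    refine ⟨x, x + Pi.single i 1, rfl, ?_⟩
    rw [Finset.sum_eq_single i] <;> simp +contextual
  · rintro ⟨x, y, rfl, h⟩
    obtain ⟨i, hi⟩ : ∃ i, x i - y i ≠ 0 := by
      by_contra hc
      push Not at hc
      simp [hc] at h
    have hsplit := Finset.add_sum_erase Finset.univ (fun j => (x j - y j) ^ 2) (Finset.mem_univ i)
    have hnn : 0 ≤ ∑ j ∈ Finset.univ.erase i, (x j - y j) ^ 2 :=
      Finset.sum_nonneg fun j _ => sq_nonneg _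
    have hpos : 0 < (x i - y i) ^ 2 := by positivity
    have h0 : ∑ j ∈ Finset.univ.erase i, (x j - y j) ^ 2 = 0 := by omega
    have hi1 : (x i - y i) ^ 2 = 1 := by omega
    have hj : ∀ j, j ≠ i → x j = y j := by
      intro j hji
      have := (Finset.sum_eq_zero_iff_of_nonneg fun j _ => sq_nonneg (x j - y j)).1 h0 j
        (Finset.mem_erase.2 ⟨hji, Finset.mem_univ j⟩)
      have := pow_eq_zero_iff (two_ne_zero) |>.1 this
      omega
    rcases (by simpa using hi1 : x i - y i = 1 ∨ x i - y i = -1) with h1 | h1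
    · refine ⟨(y, i), ?_⟩
      rw [bondEnds, lower, upper, Sym2.eq_swap]
      congr 2
      ext j
      by_cases hji : j = i
      · subst hji; simp; omega
      · simp [hji, hj j hji]
    · refine ⟨(x, i), ?_⟩
      rw [bondEnds, lower, upper]
      congr 2
      ext j
      by_cases hji : j = i
      · subst hji; simp; omega
      · simp [hji, hj j hji]

/-- The box `B(y, n) = y + ([-n, n] ∩ ℤ)^d`. -/
noncomputable def box {d : ℕ} (y : Vertex d) (n : ℕ) : Finset (Vertex d) :=
  Fintype.piFinset fun i => Finset.Icc (y i - n) (y i + n)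

/-- The set of bonds both of whose end points lie in `S`. -/
noncomputable def bondsIn {d : ℕ} (S : Finset (Vertex d)) : Finset (Bond d) :=
  (S ×ˢ Finset.univ).filter fun e => upper e ∈ S

theorem mem_bondsIn {d : ℕ} {S : Finset (Vertex d)} {e : Bond d} :
    e ∈ bondsIn S ↔ lower e ∈ S ∧ upper e ∈ S := by
  simp [bondsIn, lower]

/-- The discrete derivative `∇f`, a function on bonds. -/
def grad {d : ℕ} (f : Vertex d → ℝ) : Bond d → ℝ := fun e => f (upper e) - f (lower e)

/-- The discrete divergence
`∇^*F (x) = ∑_i (F {x - e_i, x} - F {x, x + e_i})`. -/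
def dvg {d : ℕ} (F : Bond d → ℝ) : Vertex d → ℝ :=
  fun x => ∑ i : Fin d, (F (x - Pi.single i 1, i) - F (x, i))

/-- The normalized `L^p` norm of `f` over a finite set `S` (of vertices or of bonds):
`((1 / |S|) ∑_{x ∈ S} |f x| ^ p) ^ (1 / p)` for finite `p`, and the maximum of `|f|` over `S`
for `p = ∞`. -/
noncomputable def avgNorm {ι : Type*} (p : ℝ≥0∞) (S : Finset ι) (f : ι → ℝ) : ℝ :=
  if p = ∞ then ⨆ x : S, |f x|
  else ((S.card : ℝ)⁻¹ * ∑ x ∈ S, |f x| ^ p.toReal) ^ (1 / p.toReal)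

/-- The quantity `Λ^ω(S)`: the product of the normalized `L^p` norm of `ω` and the normalized
`L^q` norm of `ω⁻¹`, both over the bonds inside `S`. -/
noncomputable def ellipticity {d : ℕ} (p q : ℝ≥0∞) (ω : Bond d → ℝ) (S : Finset (Vertex d)) : ℝ :=
  avgNorm p (bondsIn S) ω * avgNorm q (bondsIn S) fun e => (ω e)⁻¹

/-- The exponent `δ = 1 / (d - 1) - 1 / (2p) - 1 / (2q)`, where `1 / ∞ = 0`. -/
noncomputable def gap (d : ℕ) (p q : ℝ≥0∞) : ℝ :=
  1 / ((d : ℝ) - 1) - (p⁻¹).toReal / 2 - (q⁻¹).toReal / 2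

end RandomConductance
open RandomConductance

/-!
The proof is a Moser iteration in which the cutoff functions are optimised over radial profiles.
Testing the equation with `η² u |u| ^ (2 α - 2)` bounds the energy of `|u| ^ α` on `B(ρ)` by a sum
over the layers of bonds, between the radii `ρ` and `σ`, across which `η` changes. On at least half
of these layers both the mass of `ω ^ p` and the Sobolev energy of `|u| ^ α` are at most a constant
times their averages over all layers, and `η` is chosen to decrease only there. A good layer is made
of bonds with end points on the faces of a cube, where the `(d - 1)`-dimensional Sobolev inequality
applies; this is how `1 / (d - 1)` enters the gap `δ`. With `r = 2 q / (q + 1)`, the result is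
`‖|u| ^ (α (1 + δ))‖_{W^{1,r}(B(ρ))} ≤ C √(α Λ) (n / (σ - ρ))² ‖|u| ^ α‖_{W^{1,r}(B(σ))} ^ (1 + δ)`.
This is iterated along the radii `n + ⌊n / 2 ^ k⌋` for `k ≤ log₂ n`. The pointwise bound at the end
costs a factor `n ^ d`, which is harmless because its root of order `(1 + δ) ^ (log₂ n)` is bounded.
-/

namespace RandomConductance

theorem sum_rpow_mul_rpow_le {ι : Type*} (s : Finset ι) {A B : ι → ℝ} {θ : ℝ}
    (hθ₀ : 0 ≤ θ) (hθ₁ : θ ≤ 1) (hA : ∀ i ∈ s, 0 ≤ A i) (hB : ∀ i ∈ s, 0 ≤ B i) :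
    ∑ i ∈ s, A i ^ (1 - θ) * B i ^ θ ≤ (∑ i ∈ s, A i) ^ (1 - θ) * (∑ i ∈ s, B i) ^ θ := by
  rcases hθ₀.eq_or_lt with rfl | hθ₀
  · simp
  rcases hθ₁.eq_or_lt with rfl | hθ₁
  · simp
  have hconj : (1 / (1 - θ)).HolderConjugate (1 / θ) :=
    Real.holderConjugate_iff.2 ⟨by rw [lt_div_iff₀ (by linarith)]; linarith, by simp⟩
  have hroot : ∀ {C : ι → ℝ} {a : ℝ}, 0 < a → (∀ i ∈ s, 0 ≤ C i) →
      ∑ i ∈ s, (C i ^ a) ^ (1 / a) = ∑ i ∈ s, C i := fun ha hC =>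
    Finset.sum_congr rfl fun i hi => by
      rw [← Real.rpow_mul (hC i hi), mul_one_div_cancel ha.ne', Real.rpow_one]
  have holder := Real.inner_le_Lp_mul_Lq_of_nonneg s hconj
    (fun i hi => Real.rpow_nonneg (hA i hi) (1 - θ)) (fun i hi => Real.rpow_nonneg (hB i hi) θ)
  rwa [one_div_one_div, one_div_one_div, hroot (by linarith) hA, hroot hθ₀ hB] at holder

theorem rpow_sub_rpow_le {x y β : ℝ} (hβ : 1 ≤ β) (hx : 0 ≤ x) (hxy : x ≤ y) :
    y ^ β - x ^ β ≤ β * y ^ (β - 1) * (y - x) := by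
  rcases hxy.eq_or_lt with rfl | hxy
  · simp
  have hslope := (convexOn_rpow hβ).slope_le_of_hasDerivAt hx (hx.trans hxy.le) hxy
    (Real.hasDerivAt_rpow_const (Or.inr hβ))
  rwa [slope_def_field, div_le_iff₀ (sub_pos.2 hxy)] at hslope

theorem abs_rpow_sub_rpow_le {x y β : ℝ} (hβ : 1 ≤ β) (hx : 0 ≤ x) (hy : 0 ≤ y) :
    |y ^ β - x ^ β| ≤ β * max x y ^ (β - 1) * |y - x| := by
  wlog hxy : x ≤ y generalizing x y
  · rw [abs_sub_comm, abs_sub_comm y, max_comm]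
    exact this hy hx (le_of_not_ge hxy)
  rw [abs_of_nonneg (sub_nonneg.2 (Real.rpow_le_rpow hx hxy (by linarith))),
    abs_of_nonneg (sub_nonneg.2 hxy), max_eq_right hxy]
  exact rpow_sub_rpow_le hβ hx hxy

section PowerPairing

variable {x y α : ℝ}

theorem rpow_two_mul_sub_one (hα : 1 ≤ α) (hx : 0 ≤ x) :
    x ^ (2 * α - 1) = x ^ (α - 1) * x ^ α := by
  rw [← Real.rpow_add' hx (by linarith)]
  ring_nf

theorem sub_mul_rpow_two_mul_sub_one_le (hα : 1 ≤ α) (hx : 0 ≤ x) (hxy : x ≤ y) :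
    (y - x) * x ^ (2 * α - 1) ≤ (y ^ α) ^ 2 := by
  have hy := hx.trans hxy
  calc (y - x) * x ^ (2 * α - 1) ≤ y * y ^ (2 * α - 1) := by
        gcongr
        · linarith
        · linarith
    _ = (y ^ α) ^ 2 := by
        rw [← Real.rpow_one_add' hy (by linarith), ← Real.rpow_mul_natCast hy]
        ring_nf

theorem rpow_mul_sub_rpow_le (hα : 1 ≤ α) (hx : 0 ≤ x) (hxy : x ≤ y) :
    y ^ (α - 1) * (y ^ α - x ^ α) ≤ y ^ (2 * α - 1) - x ^ (2 * α - 1) := by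
  have hmono : x ^ (α - 1) * x ^ α ≤ y ^ (α - 1) * x ^ α := by gcongr
  rw [rpow_two_mul_sub_one hα hx, rpow_two_mul_sub_one hα (hx.trans hxy)]
  linarith

theorem sq_rpow_sub_rpow_le (hα : 1 ≤ α) (hx : 0 ≤ x) (hxy : x ≤ y) :
    (y ^ α - x ^ α) ^ 2 ≤ α * ((y - x) * (y ^ (2 * α - 1) - x ^ (2 * α - 1))) := by
  have hsub : 0 ≤ y ^ α - x ^ α := sub_nonneg.2 (by gcongr)
  calc (y ^ α - x ^ α) ^ 2 = (y ^ α - x ^ α) * (y ^ α - x ^ α) := sq _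
    _ ≤ α * y ^ (α - 1) * (y - x) * (y ^ α - x ^ α) := by
        gcongr
        exact rpow_sub_rpow_le hα hx hxy
    _ = α * ((y - x) * (y ^ (α - 1) * (y ^ α - x ^ α))) := by ring
    _ ≤ _ := by
        gcongr
        exact rpow_mul_sub_rpow_le hα hx hxy

theorem sq_sub_mul_rpow_le (hα : 1 ≤ α) (hx : 0 ≤ x) (hxy : x ≤ y) :
    ((y - x) * x ^ (2 * α - 1)) ^ 2 ≤
      (y - x) * (y ^ (2 * α - 1) - x ^ (2 * α - 1)) * (y ^ α) ^ 2 := by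
  have hy := hx.trans hxy
  have hα' : 0 ≤ α - 1 := sub_nonneg.2 hα
  have hsub : 0 ≤ y - x := sub_nonneg.2 hxy
  have hslope : x ^ (α - 1) * (y - x) ≤ y ^ α - x ^ α := by
    have hmono : x ^ (α - 1) * y ≤ y ^ (α - 1) * y := by gcongr
    have hpow : ∀ {z : ℝ}, 0 ≤ z → z ^ (α - 1) * z = z ^ α := fun hz => by
      rw [← Real.rpow_add_one' hz (by linarith), sub_add_cancel]
    linarith [hpow hx, hpow hy]
  have hbound : x ^ (α - 1) * (x ^ (α - 1) * (y - x)) ≤ y ^ (2 * α - 1) - x ^ (2 * α - 1) :=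
    (mul_le_mul (Real.rpow_le_rpow hx hxy hα') hslope (by positivity) (by positivity)).trans
      (rpow_mul_sub_rpow_le hα hx hxy)
  calc ((y - x) * x ^ (2 * α - 1)) ^ 2
      = (y - x) * (x ^ (α - 1) * (x ^ (α - 1) * (y - x))) * (x ^ α) ^ 2 := by
        rw [rpow_two_mul_sub_one hα hx]; ring
    _ ≤ _ := by
        refine mul_le_mul (by gcongr) (by gcongr) (by positivity) (mul_nonneg hsub ?_)
        exact hbound.trans' (by positivity)

end PowerPairing

theorem half_sq_mul_sub_le {P Q X : ℝ} (g h : ℝ) (hP : 0 ≤ P) (hXQ : X ≤ Q ^ 2)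
    (hX : X ^ 2 ≤ P * Q ^ 2) :
    1 / 2 * (g ^ 2 * P) - 3 * ((g - h) ^ 2 * Q ^ 2) ≤ g ^ 2 * P + (g ^ 2 - h ^ 2) * X := by
  have young : 2 * g * (h - g) * X ≤ 1 / 2 * (g ^ 2 * P) + 2 * ((g - h) ^ 2 * Q ^ 2) := by
    refine le_of_sq_le_sq ?_ (by positivity)
    calc (2 * g * (h - g) * X) ^ 2 = 4 * (g * (h - g)) ^ 2 * X ^ 2 := by ring
      _ ≤ 4 * (g * (h - g)) ^ 2 * (P * Q ^ 2) := by gcongr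
      _ = 4 * (1 / 2 * (g ^ 2 * P)) * (2 * ((g - h) ^ 2 * Q ^ 2)) := by ring
      _ ≤ _ := four_mul_le_sq_add _ _
  have hdiff : (g - h) ^ 2 * X ≤ (g - h) ^ 2 * Q ^ 2 := by gcongr
  linarith

/-- The odd power `s ↦ sign s |s| ^ (2 α - 1)`, to be used as a test function. -/
noncomputable def oddPow (α s : ℝ) : ℝ := s * |s| ^ (2 * α - 2)

theorem abs_sub_abs_mul_le_sub_mul_oddPow {x y α : ℝ} (g h : ℝ) (hα : 1 ≤ α) :
    (|y| - |x|) * (g ^ 2 * |y| ^ (2 * α - 1) - h ^ 2 * |x| ^ (2 * α - 1)) ≤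
      (y - x) * (g ^ 2 * oddPow α y - h ^ 2 * oddPow α x) := by
  have hpow : ∀ s : ℝ, |s| ^ (2 * α - 1) = |s| * |s| ^ (2 * α - 2) := fun s => by
    rw [← Real.rpow_one_add' (abs_nonneg s) (by linarith)]
    ring_nf
  have hxy : 0 ≤ |x| * |y| - x * y := by rw [← abs_mul]; linarith [le_abs_self (x * y)]
  have hcross : 0 ≤ (|x| * |y| - x * y) *
      (g ^ 2 * |y| ^ (2 * α - 2) + h ^ 2 * |x| ^ (2 * α - 2)) := by positivity
  rw [hpow, hpow, oddPow, oddPow]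
  linear_combination hcross + g ^ 2 * |y| ^ (2 * α - 2) * sq_abs y +
    h ^ 2 * |x| ^ (2 * α - 2) * sq_abs x

theorem sq_mul_sq_rpow_sub_le {x y α : ℝ} (g h : ℝ) (hα : 1 ≤ α) (hxy : |x| ≤ |y|) :
    g ^ 2 * (|y| ^ α - |x| ^ α) ^ 2 ≤
      2 * α * ((y - x) * (g ^ 2 * oddPow α y - h ^ 2 * oddPow α x))
        + 6 * α * ((g - h) ^ 2 * (|y| ^ α) ^ 2) := by
  have hx := abs_nonneg x
  have hpair := sq_rpow_sub_rpow_le hα hx hxy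
  have hP : 0 ≤ (|y| - |x|) * (|y| ^ (2 * α - 1) - |x| ^ (2 * α - 1)) :=
    mul_nonneg (sub_nonneg.2 hxy)
      (sub_nonneg.2 (Real.rpow_le_rpow hx hxy (by linarith)))
  have habsorb := half_sq_mul_sub_le g h hP (sub_mul_rpow_two_mul_sub_one_le hα hx hxy)
    (sq_sub_mul_rpow_le hα hx hxy)
  have htest := abs_sub_abs_mul_le_sub_mul_oddPow (x := x) (y := y) g h hα
  calc g ^ 2 * (|y| ^ α - |x| ^ α) ^ 2
      ≤ 2 * α * (1 / 2 *
          (g ^ 2 * ((|y| - |x|) * (|y| ^ (2 * α - 1) - |x| ^ (2 * α - 1))))) := by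
        linarith [mul_le_mul_of_nonneg_left hpair (sq_nonneg g)]
    _ ≤ 2 * α * ((y - x) * (g ^ 2 * oddPow α y - h ^ 2 * oddPow α x)
          + 3 * ((g - h) ^ 2 * (|y| ^ α) ^ 2)) := by
        gcongr
        linarith
    _ = _ := by ring

theorem min_sq_mul_sq_rpow_sub_le {x y g h α : ℝ} (hα : 1 ≤ α) (hg : 0 ≤ g) (hh : 0 ≤ h) :
    min g h ^ 2 * (|y| ^ α - |x| ^ α) ^ 2 ≤
      2 * α * ((y - x) * (g ^ 2 * oddPow α y - h ^ 2 * oddPow α x))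
        + 6 * α * ((g - h) ^ 2 * max (|x| ^ α) (|y| ^ α) ^ 2) := by
  wlog hxy : |x| ≤ |y| generalizing x y g h
  · have := this hh hg (le_of_not_ge hxy)
    rw [min_comm, max_comm]
    linarith
  rw [max_eq_right (by gcongr)]
  refine le_trans ?_ (sq_mul_sq_rpow_sub_le g h hα hxy)
  gcongr
  exact min_le_left _ _

/-! ### Sobolev inequality on a discrete cube -/

section Gagliardo

variable {ι α : Type*} [Fintype ι] [DecidableEq ι] [Countable α]

theorem ennreal_sum_rpow_le_of_le_sum_line (hι : 1 < Fintype.card ι) (A : ι → Finset α)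
    {f F : (ι → α) → ℝ≥0∞}
    (hfF : ∀ x ∈ Fintype.piFinset A, ∀ i, f x ≤ ∑ t ∈ A i, F (Function.update x i t)) :
    ∑ x ∈ Fintype.piFinset A, f x ^ (Fintype.card ι : ℝ).conjExponent ≤
      (∑ x ∈ Fintype.piFinset A, F x) ^ (Fintype.card ι : ℝ).conjExponent := by
  classical
  let _ : MeasurableSpace α := ⊤
  have hcard : (1 : ℝ) < Fintype.card ι := by exact_mod_cast hι
  let G : (ι → α) → ℝ≥0∞ := fun x => if x ∈ Fintype.piFinset A then F x else 0
  have hlintegral : ∀ g : (ι → α) → ℝ≥0∞,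
      ∫⁻ x, g x ∂.pi (fun _ => .count) = ∑' x, g x := fun g => by
    rw [MeasureTheory.lintegral_countable']
    simp [MeasureTheory.Measure.pi_singleton]
  have hloomis := MeasureTheory.lintegral_prod_lintegral_pow_le
    (fun _ : ι => MeasureTheory.Measure.count) (Real.HolderConjugate.conjExponent hcard)
    (measurable_of_countable G)
  have hG : ∑' x, G x = ∑ x ∈ Fintype.piFinset A, F x := by
    rw [tsum_eq_sum (s := Fintype.piFinset A) fun x hx => if_neg hx]
    exact Finset.sum_congr rfl fun x hx => if_pos hx
  rw [hlintegral, hlintegral, hG] at hloomis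
  refine le_trans (le_trans (Finset.sum_le_sum fun x hx => ?_)
    (ENNReal.sum_le_tsum (Fintype.piFinset A))) hloomis
  have hline : ∀ i, f x ≤ ∫⁻ t, G (Function.update x i t) ∂.count := fun i => by
    rw [MeasureTheory.lintegral_count]
    refine ((hfF x hx i).trans_eq (Finset.sum_congr rfl fun t ht => (if_pos ?_).symm)).trans
      (ENNReal.sum_le_tsum (A i))
    rw [Fintype.mem_piFinset] at hx ⊢
    intro j
    rcases eq_or_ne j i with rfl | hji
    · simpa using ht
    · simpa [hji] using hx j
  calc f x ^ (Fintype.card ι : ℝ).conjExponent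
      = ∏ _i : ι, f x ^ (1 / ((Fintype.card ι : ℝ) - 1)) := by
        rw [Finset.prod_const, Finset.card_univ, ← ENNReal.rpow_natCast, ← ENNReal.rpow_mul,
          one_div_mul_eq_div, Real.conjExponent]
    _ ≤ _ := Finset.prod_le_prod' fun i _ => ENNReal.rpow_le_rpow (hline i)
        (one_div_nonneg.2 (sub_nonneg.2 hcard.le))

theorem sum_rpow_le_of_le_sum_line (hι : 1 < Fintype.card ι) (A : ι → Finset α)
    {f F : (ι → α) → ℝ} (hf : ∀ x, 0 ≤ f x) (hF : ∀ x, 0 ≤ F x)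
    (hfF : ∀ x ∈ Fintype.piFinset A, ∀ i, f x ≤ ∑ t ∈ A i, F (Function.update x i t)) :
    ∑ x ∈ Fintype.piFinset A, f x ^ (Fintype.card ι : ℝ).conjExponent ≤
      (∑ x ∈ Fintype.piFinset A, F x) ^ (Fintype.card ι : ℝ).conjExponent := by
  have hconj : 0 ≤ (Fintype.card ι : ℝ).conjExponent :=
    (Real.HolderConjugate.conjExponent (by exact_mod_cast hι)).symm.nonneg
  have hsum : 0 ≤ ∑ x ∈ Fintype.piFinset A, F x := Finset.sum_nonneg fun x _ => hF x
  have hennreal := ennreal_sum_rpow_le_of_le_sum_line hι A (f := fun x => .ofReal (f x))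
    (F := fun x => .ofReal (F x)) fun x hx i => by
      rw [← ENNReal.ofReal_sum_of_nonneg fun t _ => hF _]
      exact ENNReal.ofReal_le_ofReal (hfF x hx i)
  simp only [ENNReal.ofReal_rpow_of_nonneg (hf _) hconj] at hennreal
  rwa [← ENNReal.ofReal_sum_of_nonneg fun x _ => hF x, ENNReal.ofReal_rpow_of_nonneg hsum hconj,
    ← ENNReal.ofReal_sum_of_nonneg fun x _ => Real.rpow_nonneg (hf x) _,
    ENNReal.ofReal_le_ofReal_iff (Real.rpow_nonneg hsum _)] at hennreal

end Gagliardo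

theorem abs_sub_le_sum_abs_sub (g : ℤ → ℝ) {a b s t : ℤ} (hs : s ∈ Finset.Icc a b)
    (ht : t ∈ Finset.Icc a b) : |g t - g s| ≤ ∑ j ∈ Finset.Ico a b, |g (j + 1) - g j| := by
  wlog hst : s ≤ t generalizing s t
  · rw [abs_sub_comm]
    exact this ht hs (le_of_not_ge hst)
  rw [Finset.mem_Icc] at hs ht
  refine le_trans ?_ (Finset.sum_le_sum_of_subset_of_nonneg (Finset.Ico_subset_Ico hs.1 ht.2)
    fun _ _ _ => abs_nonneg _)
  induction t, hst using Int.leInduction with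
  | base => simp
  | succ t hst ih =>
    rw [← Finset.sum_Ico_add_eq_sum_Ico_add_one hst]
    linarith [abs_sub_le (g (t + 1)) (g t) (g s), ih ⟨by omega, by omega⟩]

theorem le_sum_abs_sub_add_sum {g : ℤ → ℝ} (hg : ∀ t, 0 ≤ g t) {a b s : ℤ}
    (hs : s ∈ Finset.Icc a b) {L : ℝ} (hL : 0 < L) (hLab : L ≤ b + 1 - a) :
    g s ≤ ∑ j ∈ Finset.Ico a b, |g (j + 1) - g j| + L⁻¹ * ∑ t ∈ Finset.Icc a b, g t := by
  set D := ∑ j ∈ Finset.Ico a b, |g (j + 1) - g j|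
  have hcard : ((Finset.Icc a b).card : ℝ) = b + 1 - a := by
    rw [Finset.mem_Icc] at hs
    rw [Int.card_Icc, ← Int.cast_natCast, Int.toNat_of_nonneg (by omega)]
    push_cast
    rfl
  have havg : (b + 1 - a) * (g s - D) ≤ ∑ t ∈ Finset.Icc a b, g t := by
    rw [← hcard, ← nsmul_eq_mul]
    refine Finset.card_nsmul_le_sum _ _ _ fun t ht => ?_
    linarith [le_abs_self (g s - g t), abs_sub_le_sum_abs_sub g ht hs]
  rw [← sub_le_iff_le_add', ← div_eq_inv_mul, le_div_iff₀' hL]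
  rcases le_total 0 (g s - D) with hsign | hsign
  · exact (mul_le_mul_of_nonneg_right hLab hsign).trans havg
  · exact (mul_nonpos_of_nonneg_of_nonpos hL.le hsign).trans (Finset.sum_nonneg fun t _ => hg t)

section Lattice

variable {d : ℕ}

theorem upper_update (x : Vertex d) (i : Fin d) (j : ℤ) :
    upper (Function.update x i j, i) = Function.update x i (j + 1) := by
  ext l
  rcases eq_or_ne l i with rfl | hl
  · simp [upper]
  · simp [upper, hl]

theorem mem_box_zero {x : Vertex d} {n : ℕ} : x ∈ box 0 n ↔ ∀ i, -(n : ℤ) ≤ x i ∧ x i ≤ n := by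
  simp [box]

theorem update_mem_box {x : Vertex d} {n : ℕ} (hx : x ∈ box 0 n) {i : Fin d} {t : ℤ}
    (ht : t ∈ Finset.Icc (-(n : ℤ)) n) : Function.update x i t ∈ box 0 n := by
  rw [mem_box_zero] at hx ⊢
  intro j
  rcases eq_or_ne j i with rfl | hj
  · simpa using ht
  · simpa [hj] using hx j

theorem sum_abs_sub_line_le (f : Vertex d → ℝ) {k : ℕ} {x : Vertex d} (hx : x ∈ box 0 k)
    (i : Fin d) :
    ∑ j ∈ Finset.Ico (-(k : ℤ)) k,
        |f (Function.update x i (j + 1)) - f (Function.update x i j)| ≤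
      ∑ t ∈ Finset.Icc (-(k : ℤ)) k,
        ∑ e ∈ bondsIn (box 0 k) with lower e = Function.update x i t, |grad f e| := by
  refine le_trans (Finset.sum_le_sum fun j hj => ?_) (Finset.sum_le_sum_of_subset_of_nonneg
    Finset.Ico_subset_Icc_self fun t _ _ => Finset.sum_nonneg fun e _ => abs_nonneg (grad f e))
  have hmem : (Function.update x i j, i) ∈ bondsIn (box 0 k) := by
    rw [Finset.mem_Ico] at hj
    rw [mem_bondsIn, upper_update]
    exact ⟨update_mem_box hx (Finset.mem_Icc.2 (by omega)),
      update_mem_box hx (Finset.mem_Icc.2 (by omega))⟩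
  rw [← upper_update]
  exact Finset.single_le_sum (f := fun e => |grad f e|) (fun e _ => abs_nonneg _)
    (Finset.mem_filter.2 ⟨hmem, rfl⟩)

/-- The first order Sobolev energy of `v` with exponent `t` on `S`, where `L` is the length scale
that makes the two terms comparable. It is a plain sum, not normalized by `|S|`. -/
noncomputable def sobolevSum (t L : ℝ) (v : Vertex d → ℝ) (S : Finset (Vertex d)) : ℝ :=
  ∑ e ∈ bondsIn S, |grad v e| ^ t + L ^ (-t) * ∑ x ∈ S, |v x| ^ t

theorem sobolevSum_nonneg {L : ℝ} (hL : 0 ≤ L) (t : ℝ) (v : Vertex d → ℝ)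
    (S : Finset (Vertex d)) : 0 ≤ sobolevSum t L v S := by
  unfold sobolevSum
  positivity

theorem sum_rpow_conjExponent_le {m : ℕ} (hm : 2 ≤ m) (k : ℕ) {L : ℝ} (hL : 0 < L)
    (hLk : L ≤ 2 * k + 1) {f : Vertex m → ℝ} (hf : ∀ x, 0 ≤ f x) :
    ∑ x ∈ box 0 k, f x ^ (m : ℝ).conjExponent ≤
      sobolevSum 1 L f (box 0 k) ^ (m : ℝ).conjExponent := by
  let F : Vertex m → ℝ := fun x =>
    ∑ e ∈ bondsIn (box 0 k) with lower e = x, |grad f e| + L⁻¹ * f x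
  have hF : ∀ x, 0 ≤ F x := fun x =>
    add_nonneg (Finset.sum_nonneg fun e _ => abs_nonneg _)
      (mul_nonneg (inv_nonneg.2 hL.le) (hf x))
  have hsum : sobolevSum 1 L f (box 0 k) = ∑ x ∈ box 0 k, F x := by
    rw [Finset.sum_add_distrib, ← Finset.mul_sum,
      Finset.sum_fiberwise_of_maps_to fun e he => (mem_bondsIn.1 he).1]
    simp [sobolevSum, Real.rpow_neg_one, abs_of_nonneg (hf _)]
  have hbox : box (0 : Vertex m) k = Fintype.piFinset fun _ => Finset.Icc (-(k : ℤ)) k := by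
    simp [box]
  have hline : ∀ x ∈ box 0 k, ∀ i,
      f x ≤ ∑ t ∈ Finset.Icc (-(k : ℤ)) k, F (Function.update x i t) := fun x hx i => by
    have hL' : L ≤ (k : ℤ) + 1 - (-(k : ℤ) : ℤ) := by push_cast; linarith
    have hone := le_sum_abs_sub_add_sum (g := fun t => f (Function.update x i t))
      (fun t => hf _) (Finset.mem_Icc.2 (mem_box_zero.1 hx i)) hL hL'
    rw [Function.update_eq_self] at hone
    rw [Finset.sum_add_distrib, ← Finset.mul_sum]
    exact hone.trans (by gcongr; exact sum_abs_sub_line_le f hx i)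
  rw [hsum]
  rw [hbox] at hline ⊢
  simpa only [Fintype.card_fin] using
    sum_rpow_le_of_le_sum_line (by rwa [Fintype.card_fin]) _ hf hF hline

/-- The larger of the values of `v` at the two end points of a bond. -/
def bondMax (v : Vertex d → ℝ) (e : Bond d) : ℝ := max (v (lower e)) (v (upper e))

theorem bondMax_nonneg {v : Vertex d → ℝ} (hv : ∀ x, 0 ≤ v x) (e : Bond d) : 0 ≤ bondMax v e :=
  le_max_of_le_left (hv _)

theorem bondMax_rpow {v : Vertex d → ℝ} (hv : ∀ x, 0 ≤ v x) {s : ℝ} (hs : 0 ≤ s) (e : Bond d) :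
    bondMax (fun x => v x ^ s) e = bondMax v e ^ s :=
  (Real.rpow_max (hv _) (hv _) hs).symm

theorem abs_grad_rpow_le {g : Vertex d → ℝ} (hg : ∀ x, 0 ≤ g x) {β : ℝ} (hβ : 1 ≤ β)
    (e : Bond d) :
    |grad (fun x => g x ^ β) e| ≤ β * bondMax g e ^ (β - 1) * |grad g e| :=
  abs_rpow_sub_rpow_le hβ (hg _) (hg _)

theorem injective_upper_snd : Function.Injective fun e : Bond d => (upper e, e.2) := by
  rintro ⟨x, i⟩ ⟨y, j⟩ h
  obtain ⟨hxy, rfl⟩ := Prod.mk.inj h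
  exact Prod.ext (add_right_cancel hxy) rfl

theorem sum_bondMax_le (S : Finset (Vertex d)) {v : Vertex d → ℝ} (hv : ∀ x, 0 ≤ v x) :
    ∑ e ∈ bondsIn S, bondMax v e ≤ 2 * d * ∑ x ∈ S, v x := by
  have hsum : ∀ ε : Bond d → Bond d, Function.Injective ε →
      (∀ e ∈ bondsIn S, (ε e).1 ∈ S) → ∑ e ∈ bondsIn S, v (ε e).1 ≤ d * ∑ x ∈ S, v x := by
    intro ε hinj hmem
    calc ∑ e ∈ bondsIn S, v (ε e).1 = ∑ e ∈ (bondsIn S).image ε, v e.1 := by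
          rw [Finset.sum_image hinj.injOn]
      _ ≤ ∑ e ∈ S ×ˢ Finset.univ, v e.1 := by
          refine Finset.sum_le_sum_of_subset_of_nonneg (Finset.image_subset_iff.2 fun e he => ?_)
            fun _ _ _ => hv _
          simpa using hmem e he
      _ = _ := by rw [Finset.sum_product]; simp [Finset.mul_sum]
  have hlower := hsum id Function.injective_id fun e he => (mem_bondsIn.1 he).1
  have hupper := hsum _ injective_upper_snd fun e he => (mem_bondsIn.1 he).2
  calc ∑ e ∈ bondsIn S, bondMax v e ≤ ∑ e ∈ bondsIn S, (v (lower e) + v (upper e)) :=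
        Finset.sum_le_sum fun e _ => max_le_add_of_nonneg (hv _) (hv _)
    _ ≤ _ := by
        rw [Finset.sum_add_distrib, mul_assoc, two_mul]
        exact add_le_add hlower hupper

end Lattice

section ChainRule

variable {d : ℕ} {t r β s : ℝ} {g : Vertex d → ℝ}

theorem sum_abs_grad_rpow_rpow_le (S : Finset (Vertex d)) (ht : 0 < t) (htr : t ≤ r) (hβ : 1 ≤ β)
    (hs : 0 ≤ s) (hsβ : s * (1 - t / r) = (β - 1) * t) (hg : ∀ x, 0 ≤ g x) :
    ∑ e ∈ bondsIn S, |grad (fun x => g x ^ β) e| ^ t ≤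
      β ^ t * (2 * d * ∑ x ∈ S, g x ^ s) ^ (1 - t / r) *
        (∑ e ∈ bondsIn S, |grad g e| ^ r) ^ (t / r) := by
  have hr : 0 < r := ht.trans_le htr
  have hθ₁ : t / r ≤ 1 := (div_le_one hr).2 htr
  have hterm : ∀ e, |grad (fun x => g x ^ β) e| ^ t ≤
      β ^ t * ((bondMax g e ^ s) ^ (1 - t / r) * (|grad g e| ^ r) ^ (t / r)) := fun e => by
    have hmax := bondMax_nonneg hg e
    calc |grad (fun x => g x ^ β) e| ^ t ≤ (β * bondMax g e ^ (β - 1) * |grad g e|) ^ t := by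
          gcongr
          exact abs_grad_rpow_le hg hβ e
      _ = _ := by
          rw [mul_assoc, Real.mul_rpow (by linarith) (by positivity),
            Real.mul_rpow (by positivity) (abs_nonneg _), ← Real.rpow_mul hmax,
            ← Real.rpow_mul hmax, hsβ, ← Real.rpow_mul (abs_nonneg _), mul_div_cancel₀ _ hr.ne']
  calc ∑ e ∈ bondsIn S, |grad (fun x => g x ^ β) e| ^ t
      ≤ β ^ t * ∑ e ∈ bondsIn S,
          (bondMax g e ^ s) ^ (1 - t / r) * (|grad g e| ^ r) ^ (t / r) := by
        rw [Finset.mul_sum]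
        exact Finset.sum_le_sum fun e _ => hterm e
    _ ≤ β ^ t * ((∑ e ∈ bondsIn S, bondMax g e ^ s) ^ (1 - t / r) *
          (∑ e ∈ bondsIn S, |grad g e| ^ r) ^ (t / r)) := by
        gcongr
        exact sum_rpow_mul_rpow_le _ (by positivity) hθ₁
          (fun e _ => Real.rpow_nonneg (bondMax_nonneg hg e) _)
          fun e _ => Real.rpow_nonneg (abs_nonneg _) _
    _ ≤ β ^ t * ((2 * d * ∑ x ∈ S, g x ^ s) ^ (1 - t / r) *
          (∑ e ∈ bondsIn S, |grad g e| ^ r) ^ (t / r)) := by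
        gcongr
        · exact Finset.sum_nonneg fun e _ => Real.rpow_nonneg (bondMax_nonneg hg e) _
        · simpa only [bondMax_rpow hg hs] using
            sum_bondMax_le S (v := fun x => g x ^ s) fun x => Real.rpow_nonneg (hg x) _
    _ = _ := (mul_assoc _ _ _).symm

theorem rpow_neg_mul_sum_rpow_le {ι : Type*} (S : Finset ι) {g : ι → ℝ} {L : ℝ} (hL : 0 < L)
    (ht : 0 < t) (htr : t ≤ r) (hβ : 1 ≤ β) (hsβ : s * (1 - t / r) = (β - 1) * t)
    (hg : ∀ x, 0 ≤ g x) :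
    L ^ (-t) * ∑ x ∈ S, (g x ^ β) ^ t ≤
      (∑ x ∈ S, g x ^ s) ^ (1 - t / r) * (L ^ (-r) * ∑ x ∈ S, g x ^ r) ^ (t / r) := by
  have hr : 0 < r := ht.trans_le htr
  have hterm : ∀ x, L ^ (-t) * (g x ^ β) ^ t =
      (g x ^ s) ^ (1 - t / r) * (L ^ (-r) * g x ^ r) ^ (t / r) := fun x => by
    rw [Real.mul_rpow (by positivity) (Real.rpow_nonneg (hg x) _), ← Real.rpow_mul hL.le,
      ← Real.rpow_mul (hg x), ← Real.rpow_mul (hg x), ← Real.rpow_mul (hg x), neg_mul,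
      mul_div_cancel₀ _ hr.ne', hsβ, mul_left_comm,
      ← Real.rpow_add_of_nonneg (hg x) (mul_nonneg (sub_nonneg.2 hβ) ht.le) ht.le]
    ring_nf
  rw [Finset.mul_sum, Finset.mul_sum, Finset.sum_congr rfl fun x _ => hterm x]
  exact sum_rpow_mul_rpow_le _ (by positivity) ((div_le_one hr).2 htr)
    (fun x _ => Real.rpow_nonneg (hg x) _)
    fun x _ => mul_nonneg (by positivity) (Real.rpow_nonneg (hg x) _)

theorem sobolevSum_rpow_le (S : Finset (Vertex d)) {L : ℝ} (hL : 0 < L) (ht : 0 < t)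
    (htr : t ≤ r) (hβ : 1 ≤ β) (hs : 0 ≤ s) (hsβ : s * (1 - t / r) = (β - 1) * t)
    (hg : ∀ x, 0 ≤ g x) :
    sobolevSum t L (fun x => g x ^ β) S ≤
      (β ^ t * (2 * d) ^ (1 - t / r) + 1) *
        ((∑ x ∈ S, g x ^ s) ^ (1 - t / r) * sobolevSum r L g S ^ (t / r)) := by
  have hgs : 0 ≤ ∑ x ∈ S, g x ^ s := Finset.sum_nonneg fun x _ => Real.rpow_nonneg (hg x) s
  have hgr : 0 ≤ L ^ (-r) * ∑ x ∈ S, g x ^ r :=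
    mul_nonneg (by positivity) (Finset.sum_nonneg fun x _ => Real.rpow_nonneg (hg x) r)
  have hgrad : 0 ≤ ∑ e ∈ bondsIn S, |grad g e| ^ r :=
    Finset.sum_nonneg fun e _ => Real.rpow_nonneg (abs_nonneg _) r
  have hfirst := sum_abs_grad_rpow_rpow_le S ht htr hβ hs hsβ hg
  have hzero := rpow_neg_mul_sum_rpow_le S hL ht htr hβ hsβ hg
  simp only [sobolevSum, abs_of_nonneg (hg _), abs_of_nonneg (Real.rpow_nonneg (hg _) β)]
  refine (add_le_add hfirst hzero).trans ?_
  rw [Real.mul_rpow (by positivity) hgs, add_mul, one_mul, mul_assoc, mul_assoc, mul_assoc]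
  have : 0 ≤ t / r := by have := ht.trans_le htr; positivity
  gcongr <;> linarith

end ChainRule

theorem sobolev_box {m : ℕ} (hm : 2 ≤ m) {t T : ℝ} (ht : 1 ≤ t) (hT : 0 < T)
    (htT : 1 / T = 1 / t - 1 / m) :
    ∃ C : ℝ, 0 ≤ C ∧ ∀ (k : ℕ) (L : ℝ), 0 < L → L ≤ 2 * k + 1 →
      ∀ g : Vertex m → ℝ, (∀ x, 0 ≤ g x) →
        ∑ x ∈ box 0 k, g x ^ T ≤ C * sobolevSum t L g (box 0 k) ^ (T / t) := by
  have hm' : (1 : ℝ) < m := by exact_mod_cast hm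
  have hm_conj := Real.HolderConjugate.conjExponent hm'
  have ht0 : 0 < t := by linarith
  set β := T * (1 - 1 / m)
  have hβT : T * (1 - 1 / t) = (β - 1) * 1 := by
    linear_combination T * htT - mul_one_div_cancel hT.ne'
  have hβ : 1 ≤ β := by
    have : 0 ≤ T * (1 - 1 / t) := mul_nonneg hT.le (sub_nonneg.2 ((div_le_one ht0).2 ht))
    linarith
  have hconj : β * (m : ℝ).conjExponent = T := by
    have : (m : ℝ) - 1 ≠ 0 := by linarith
    simp only [β, Real.conjExponent]
    field_simp
  have hinv : (m : ℝ).conjExponent⁻¹ = 1 / T + (1 - 1 / t) := by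
    have := hm_conj.inv_add_inv_eq_one
    simp only [one_div] at htT ⊢
    linarith
  set K := β ^ (1 : ℝ) * (2 * m) ^ (1 - 1 / t) + 1
  have hK : 0 ≤ K := by positivity
  refine ⟨K ^ T, by positivity, fun k L hL hLk g hg => ?_⟩
  set G := ∑ x ∈ box 0 k, g x ^ T
  set H := sobolevSum t L g (box 0 k)
  have hH : 0 ≤ H := sobolevSum_nonneg hL.le ..
  have hG₀ : 0 ≤ G := Finset.sum_nonneg fun x _ => Real.rpow_nonneg (hg x) T
  rcases hG₀.eq_or_lt with hG | hG
  · rw [← hG]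
    positivity
  have hnirenberg : G ≤ (K * (G ^ (1 - 1 / t) * H ^ (1 / t))) ^ (m : ℝ).conjExponent := by
    have hpow := sum_rpow_conjExponent_le hm k hL hLk (f := fun x => g x ^ β)
      fun x => Real.rpow_nonneg (hg x) _
    simp only [← Real.rpow_mul (hg _), hconj] at hpow
    refine hpow.trans (Real.rpow_le_rpow (sobolevSum_nonneg hL.le ..) ?_
      hm_conj.symm.nonneg)
    exact sobolevSum_rpow_le _ hL one_pos ht hβ hT.le hβT hg
  have hroot : G ^ (1 / T) ≤ K * H ^ (1 / t) := by
    refine le_of_mul_le_mul_right ?_ (Real.rpow_pos_of_pos hG (1 - 1 / t))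
    rw [← Real.rpow_add hG, ← hinv]
    refine ((Real.rpow_inv_le_iff_of_pos hG₀ (by positivity) hm_conj.symm.pos).2
      hnirenberg).trans_eq (by ring)
  calc G = (G ^ (1 / T)) ^ T := by
        rw [← Real.rpow_mul hG₀, one_div_mul_cancel hT.ne', Real.rpow_one]
    _ ≤ (K * H ^ (1 / t)) ^ T := by gcongr
    _ = K ^ T * H ^ (T / t) := by
        rw [Real.mul_rpow hK (by positivity), ← Real.rpow_mul hH, one_div_mul_eq_div]

/-! ### Caccioppoli's inequality -/

section Radius

variable {d : ℕ}

/-- The sup norm of a vertex. -/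
def radius (x : Vertex d) : ℕ := Finset.univ.sup fun i => (x i).natAbs

theorem radius_le_iff {x : Vertex d} {n : ℕ} : radius x ≤ n ↔ ∀ i, (x i).natAbs ≤ n := by
  simp [radius]

theorem natAbs_le_radius (x : Vertex d) (i : Fin d) : (x i).natAbs ≤ radius x :=
  radius_le_iff.1 le_rfl i

theorem mem_box_zero_iff_radius {x : Vertex d} {n : ℕ} : x ∈ box 0 n ↔ radius x ≤ n := by
  rw [mem_box_zero, radius_le_iff]
  exact forall_congr' fun i => by omega

theorem radius_upper_le (e : Bond d) : radius (upper e) ≤ radius (lower e) + 1 := by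
  refine radius_le_iff.2 fun j => ?_
  have := natAbs_le_radius (lower e) j
  simp only [upper, lower, Pi.add_apply, Pi.single_apply] at this ⊢
  split_ifs <;> omega

theorem radius_lower_le (e : Bond d) : radius (lower e) ≤ radius (upper e) + 1 := by
  refine radius_le_iff.2 fun j => ?_
  have := natAbs_le_radius (upper e) j
  simp only [upper, lower, Pi.add_apply, Pi.single_apply] at this ⊢
  split_ifs at this <;> omega

theorem box_zero_mono {m n : ℕ} (hmn : m ≤ n) : box (0 : Vertex d) m ⊆ box 0 n := fun x hx => by
  rw [mem_box_zero_iff_radius] at hx ⊢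
  exact hx.trans hmn

theorem bondsIn_mono {S T : Finset (Vertex d)} (hST : S ⊆ T) : bondsIn S ⊆ bondsIn T :=
  fun _ he => mem_bondsIn.2 ((mem_bondsIn.1 he).imp (@hST _) (@hST _))

/-- The bonds connecting the spheres of radius `k` and `k + 1`. -/
noncomputable def layer (d k : ℕ) : Finset (Bond d) :=
  (bondsIn (box 0 (k + 1))).filter fun e =>
    (radius (lower e) = k ∧ radius (upper e) = k + 1) ∨
      (radius (lower e) = k + 1 ∧ radius (upper e) = k)

theorem mem_layer {k : ℕ} {e : Bond d} : e ∈ layer d k ↔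
    (radius (lower e) = k ∧ radius (upper e) = k + 1) ∨
      (radius (lower e) = k + 1 ∧ radius (upper e) = k) := by
  simp only [layer, Finset.mem_filter, mem_bondsIn, mem_box_zero_iff_radius]
  omega

theorem layer_subset {k σ : ℕ} (hk : k < σ) : layer d k ⊆ bondsIn (box 0 σ) := fun e he => by
  rw [mem_layer] at he
  rw [mem_bondsIn, mem_box_zero_iff_radius, mem_box_zero_iff_radius]
  omega

theorem pairwise_disjoint_layer (d : ℕ) : Pairwise (Function.onFun Disjoint (layer d)) :=
  fun k l hkl => Finset.disjoint_left.2 fun e hk hl => by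
    rw [mem_layer] at hk hl
    omega

/-- A radial cutoff, of value `1` near the origin, that decreases by `1 / #G` across each layer
with index in `G` and across no other. -/
noncomputable def layerCutoff (G : Finset ℕ) (x : Vertex d) : ℝ :=
  1 - (G.card : ℝ)⁻¹ * (G.filter (· < radius x)).card

theorem layerCutoff_nonneg (G : Finset ℕ) (x : Vertex d) : 0 ≤ layerCutoff G x := by
  rw [layerCutoff, sub_nonneg, inv_mul_eq_div]
  exact div_le_one_of_le₀ (by exact_mod_cast Finset.card_filter_le _ _) (by positivity)

theorem layerCutoff_eq_one {G : Finset ℕ} {x : Vertex d} (hx : ∀ k ∈ G, radius x ≤ k) :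
    layerCutoff G x = 1 := by
  simp [layerCutoff, Finset.filter_eq_empty_iff.2 fun k hk => not_lt.2 (hx k hk)]

theorem layerCutoff_eq_zero {G : Finset ℕ} (hG : G.Nonempty) {x : Vertex d}
    (hx : ∀ k ∈ G, k < radius x) : layerCutoff G x = 0 := by
  have hcard : (G.card : ℝ) ≠ 0 := by exact_mod_cast hG.card_ne_zero
  rw [layerCutoff, Finset.filter_true_of_mem hx, inv_mul_cancel₀ hcard, sub_self]

theorem sq_grad_layerCutoff (G : Finset ℕ) (e : Bond d) :
    grad (layerCutoff G) e ^ 2 = (G.card : ℝ)⁻¹ ^ 2 * ∑ k ∈ G, if e ∈ layer d k then 1 else 0 := by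
  have hgrad : grad (layerCutoff G) e = (G.card : ℝ)⁻¹ * ∑ k ∈ G,
      ((if k < radius (lower e) then 1 else 0) - if k < radius (upper e) then 1 else 0) := by
    simp only [grad, layerCutoff, Finset.sum_sub_distrib, Finset.sum_boole]
    ring
  have hupper := radius_upper_le e
  have hlower := radius_lower_le e
  rw [hgrad, mul_pow]
  congr 1
  by_cases he : ∃ k ∈ G, e ∈ layer d k
  · obtain ⟨k, hkG, hk⟩ := he
    rw [mem_layer] at hk
    rw [Finset.sum_eq_single_of_mem k hkG, Finset.sum_eq_single_of_mem k hkG,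
      if_pos (mem_layer.2 hk)]
    · rcases hk with ⟨hl, hu⟩ | ⟨hl, hu⟩ <;> simp [hl, hu]
    · intro j _ hjk
      rw [if_neg (by rw [mem_layer]; omega)]
    · intro j _ hjk
      rw [sub_eq_zero]
      congr 1
      exact propext (by omega)
  · push Not at he
    rw [Finset.sum_eq_zero fun k hk => ?_, Finset.sum_eq_zero fun k hk => if_neg (he k hk)]
    · simp
    · have := he k hk
      rw [mem_layer] at this
      rw [sub_eq_zero]
      congr 1
      exact propext (by omega)

end Radius

section Caccioppoli

variable {d : ℕ} {ω : Bond d → ℝ} {u : Vertex d → ℝ} {ρ σ : ℕ}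

theorem sum_mul_grad (F : Bond d → ℝ) {φ : Vertex d → ℝ} (hφ : ∀ x, σ ≤ radius x → φ x = 0) :
    ∑ e ∈ bondsIn (box 0 σ), F e * grad φ e = ∑ x ∈ box 0 σ, φ x * dvg F x := by
  have hlower : ∑ e ∈ bondsIn (box 0 σ), F e * φ (lower e) =
      ∑ x ∈ box 0 σ, ∑ i, F (x, i) * φ x := by
    refine Eq.trans ?_ (Finset.sum_product (box 0 σ) Finset.univ fun e : Bond d => F e * φ e.1)
    refine Finset.sum_subset (Finset.filter_subset _ _) fun e he hnot => ?_
    have hup : upper e ∉ box 0 σ := fun h => hnot (mem_bondsIn.2 ⟨(Finset.mem_product.1 he).1, h⟩)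
    have := radius_upper_le e
    rw [mem_box_zero_iff_radius] at hup
    rw [hφ _ (by omega), mul_zero]
  have hupper : ∑ e ∈ bondsIn (box 0 σ), F e * φ (upper e) =
      ∑ x ∈ box 0 σ, ∑ i, F (x - Pi.single i 1, i) * φ x := by
    have hprod := Finset.sum_product (box 0 σ) Finset.univ
      fun e : Bond d => F (e.1 - Pi.single e.2 1, e.2) * φ e.1
    refine Eq.trans ?_ hprod
    refine Finset.sum_of_injOn (fun e => (upper e, e.2)) injective_upper_snd.injOn
      (fun e he => Finset.mem_coe.2 (Finset.mem_product.2
        ⟨(mem_bondsIn.1 he).2, Finset.mem_univ _⟩)) (fun e he hnot => ?_)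
      fun e _ => by simp [upper]
    let b : Bond d := (e.1 - Pi.single e.2 1, e.2)
    have hb : upper b = e.1 := by simp [upper, b]
    have hlow : lower b ∉ box 0 σ := fun h => hnot
      ⟨b, mem_bondsIn.2 ⟨h, hb ▸ (Finset.mem_product.1 he).1⟩, by simp only [hb, b]⟩
    have := hb ▸ radius_lower_le b
    rw [mem_box_zero_iff_radius] at hlow
    rw [hφ e.1 (by omega), mul_zero]
  simp only [grad, mul_sub, Finset.sum_sub_distrib, hlower, hupper, dvg, Finset.mul_sum, mul_comm]

/-- `u` solves `∇^*(ω∇u) = 0` at every vertex of sup norm less than `σ`. -/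
def IsHarmonicWithin (ω : Bond d → ℝ) (σ : ℕ) (u : Vertex d → ℝ) : Prop :=
  ∀ x, radius x < σ → dvg (fun e => ω e * grad u e) x = 0

theorem IsHarmonicWithin.mono (hu : IsHarmonicWithin ω σ u) (hρσ : ρ ≤ σ) :
    IsHarmonicWithin ω ρ u := fun x hx => hu x (hx.trans_le hρσ)

theorem caccioppoli (hω : ∀ e, 0 < ω e) (hu : IsHarmonicWithin ω σ u) {α : ℝ} (hα : 1 ≤ α)
    (hρσ : ρ ≤ σ) {η : Vertex d → ℝ} (hη₀ : ∀ x, 0 ≤ η x) (hη₁ : ∀ x, radius x ≤ ρ → η x = 1)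
    (hησ : ∀ x, σ ≤ radius x → η x = 0) :
    ∑ e ∈ bondsIn (box 0 ρ), ω e * grad (fun x => |u x| ^ α) e ^ 2 ≤
      6 * α * ∑ e ∈ bondsIn (box 0 σ),
        ω e * (grad η e ^ 2 * bondMax (fun x => |u x| ^ α) e ^ 2) := by
  let v : Vertex d → ℝ := fun x => |u x| ^ α
  let φ : Vertex d → ℝ := fun x => η x ^ 2 * oddPow α (u x)
  have htest : ∑ e ∈ bondsIn (box 0 σ), ω e * grad u e * grad φ e = 0 := by
    rw [sum_mul_grad (fun e => ω e * grad u e) fun x hx => by simp [φ, hησ x hx]]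
    refine Finset.sum_eq_zero fun x _ => ?_
    rcases lt_or_ge (radius x) σ with hx | hx
    · rw [hu x hx, mul_zero]
    · simp [φ, hησ x hx]
  have hpointwise : ∀ e, ω e * (min (η (upper e)) (η (lower e)) ^ 2 * grad v e ^ 2) ≤
      2 * α * (ω e * grad u e * grad φ e) +
        6 * α * (ω e * (grad η e ^ 2 * bondMax v e ^ 2)) := fun e => by
    have := mul_le_mul_of_nonneg_left (min_sq_mul_sq_rpow_sub_le (x := u (lower e))
      (y := u (upper e)) hα (hη₀ (upper e)) (hη₀ (lower e))) (hω e).le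
    simp only [grad, bondMax, v, φ]
    linarith
  calc ∑ e ∈ bondsIn (box 0 ρ), ω e * grad v e ^ 2
      = ∑ e ∈ bondsIn (box 0 ρ),
          ω e * (min (η (upper e)) (η (lower e)) ^ 2 * grad v e ^ 2) := by
        refine Finset.sum_congr rfl fun e he => ?_
        rw [mem_bondsIn, mem_box_zero_iff_radius, mem_box_zero_iff_radius] at he
        simp [hη₁ _ he.1, hη₁ _ he.2]
    _ ≤ ∑ e ∈ bondsIn (box 0 σ),
          ω e * (min (η (upper e)) (η (lower e)) ^ 2 * grad v e ^ 2) :=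
        Finset.sum_le_sum_of_subset_of_nonneg (bondsIn_mono (box_zero_mono hρσ)) fun e _ _ =>
          mul_nonneg (hω e).le (by positivity)
    _ ≤ _ := Finset.sum_le_sum fun e _ => hpointwise e
    _ = _ := by
        rw [Finset.sum_add_distrib, ← Finset.mul_sum, htest, mul_zero, zero_add, ← Finset.mul_sum]

theorem caccioppoli_layers (hω : ∀ e, 0 < ω e) (hu : IsHarmonicWithin ω σ u) {α : ℝ}
    (hα : 1 ≤ α) (hρσ : ρ ≤ σ) {G : Finset ℕ} (hG : G ⊆ Finset.Ico ρ σ) (hGne : G.Nonempty) :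
    ∑ e ∈ bondsIn (box 0 ρ), ω e * grad (fun x => |u x| ^ α) e ^ 2 ≤
      6 * α * ((G.card : ℝ)⁻¹ ^ 2 * ∑ k ∈ G, ∑ e ∈ layer d k,
        ω e * bondMax (fun x => |u x| ^ α) e ^ 2) := by
  have hIco : ∀ k ∈ G, ρ ≤ k ∧ k < σ := fun k hk => Finset.mem_Ico.1 (hG hk)
  refine (caccioppoli hω hu hα hρσ (layerCutoff_nonneg G)
    (fun x hx => layerCutoff_eq_one fun k hk => hx.trans (hIco k hk).1)
    fun x hx => layerCutoff_eq_zero hGne fun k hk => (hIco k hk).2.trans_le hx).trans_eq ?_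
  set f : Bond d → ℝ := fun e => ω e * bondMax (fun x => |u x| ^ α) e ^ 2
  have hlayer : ∀ k ∈ G, ∑ e ∈ bondsIn (box 0 σ), (if e ∈ layer d k then (1 : ℝ) else 0) * f e =
      ∑ e ∈ layer d k, f e := fun k hk => by
    simp only [ite_mul, one_mul, zero_mul]
    rw [Finset.sum_ite_mem, Finset.inter_eq_right.2 (layer_subset (hIco k hk).2)]
  rw [← Finset.sum_congr rfl hlayer, Finset.sum_comm]
  refine congrArg _ ((Finset.sum_congr rfl fun e _ => ?_).trans (Finset.mul_sum _ _ _).symm)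
  rw [sq_grad_layerCutoff, ← Finset.sum_mul]
  ring

end Caccioppoli

/-! ### Sobolev inequality on a layer -/

section Slab

variable {d : ℕ} {L : ℝ}

/-- The part of `sobolevSum t L v (box 0 R)` carried by the two hyperplanes `x i = ± a`. A bond in
direction `i` is attributed to the hyperplane through its lower end point. -/
noncomputable def slab (t L : ℝ) (v : Vertex d → ℝ) (R : ℕ) (i : Fin d) (a : ℕ) : ℝ :=
  ∑ e ∈ bondsIn (box 0 R) with (lower e i).natAbs = a, |grad v e| ^ t +
    L ^ (-t) * ∑ x ∈ box 0 R with (x i).natAbs = a, |v x| ^ t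

theorem slab_nonneg (hL : 0 ≤ L) (t : ℝ) (v : Vertex d → ℝ) (R : ℕ) (i : Fin d) (a : ℕ) :
    0 ≤ slab t L v R i a := by
  unfold slab
  positivity

theorem sum_slab_le (hL : 0 ≤ L) (t : ℝ) (v : Vertex d → ℝ) (R : ℕ) (i : Fin d) (I : Finset ℕ) :
    ∑ a ∈ I, slab t L v R i a ≤ sobolevSum t L v (box 0 R) := by
  simp only [slab, sobolevSum, Finset.sum_add_distrib, ← Finset.mul_sum]
  gcongr <;>
    exact Finset.sum_fiberwise_le_sum_of_sum_fiber_nonneg fun _ _ => by positivity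

/-- The energy of `v` on the hyperplanes `x i = ± k` and `x i = ± (k + 1)`, which contain the faces
of the spheres of radius `k` and `k + 1`. -/
noncomputable def layerEnergy (t L : ℝ) (v : Vertex d → ℝ) (R k : ℕ) : ℝ :=
  ∑ i, (slab t L v R i k + slab t L v R i (k + 1))

theorem layerEnergy_nonneg (hL : 0 ≤ L) (t : ℝ) (v : Vertex d → ℝ) (R k : ℕ) :
    0 ≤ layerEnergy t L v R k :=
  Finset.sum_nonneg fun i _ => add_nonneg (slab_nonneg hL t v R i k) (slab_nonneg hL t v R i _)

theorem sum_layerEnergy_le (hL : 0 ≤ L) (t : ℝ) (v : Vertex d → ℝ) (R : ℕ) (I : Finset ℕ) :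
    ∑ k ∈ I, layerEnergy t L v R k ≤ 2 * d * sobolevSum t L v (box 0 R) := by
  have hdirection : ∀ i, ∑ k ∈ I, (slab t L v R i k + slab t L v R i (k + 1)) ≤
      2 * sobolevSum t L v (box 0 R) := fun i => by
    have hshift := sum_slab_le hL t v R i (I.map (addRightEmbedding 1))
    rw [Finset.sum_map] at hshift
    rw [Finset.sum_add_distrib, two_mul]
    exact add_le_add (sum_slab_le hL t v R i I) hshift
  simp only [layerEnergy]
  rw [Finset.sum_comm]
  refine (Finset.sum_le_sum fun i _ => hdirection i).trans_eq ?_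
  rw [Finset.sum_const, Finset.card_univ, Fintype.card_fin, nsmul_eq_mul]
  ring

theorem slab_le_layerEnergy (hL : 0 ≤ L) (t : ℝ) (v : Vertex d → ℝ) (R k : ℕ) (i : Fin d)
    {a : ℕ} (ha : a = k ∨ a = k + 1) : slab t L v R i a ≤ layerEnergy t L v R k := by
  have hslab := slab_nonneg hL t v R
  refine le_trans ?_ (Finset.single_le_sum
    (fun j _ => add_nonneg (hslab j k) (hslab j (k + 1))) (Finset.mem_univ i))
  rcases ha with rfl | rfl
  · exact le_add_of_nonneg_right (hslab i _)
  · exact le_add_of_nonneg_left (hslab i _)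

end Slab

section Slice

variable {m : ℕ}

/-- The embedding of `ℤ^m` as the hyperplane `x i = s` of `ℤ^(m+1)`. -/
abbrev slice (i : Fin (m + 1)) (s : ℤ) (z : Vertex m) : Vertex (m + 1) :=
  Fin.insertNth (α := fun _ => ℤ) i s z

theorem slice_add_single (i : Fin (m + 1)) (s : ℤ) (z : Vertex m) (j : Fin m) :
    slice i s (z + Pi.single j 1) = slice i s z + Pi.single (i.succAbove j) 1 := by
  ext l
  rcases Fin.eq_self_or_eq_succAbove i l with rfl | ⟨l, rfl⟩
  · simp [Fin.ne_succAbove]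
  · simp [Pi.single_apply]

theorem slice_mem_box {i : Fin (m + 1)} {s : ℤ} {z : Vertex m} {k R : ℕ} (hs : s.natAbs ≤ R)
    (hk : k ≤ R) (hz : z ∈ box 0 k) : slice i s z ∈ box 0 R := by
  rw [mem_box_zero_iff_radius, radius_le_iff] at hz ⊢
  intro l
  rcases Fin.eq_self_or_eq_succAbove i l with rfl | ⟨l, rfl⟩
  · simpa using hs
  · simpa using (hz l).trans hk

theorem sobolevSum_slice_le {L : ℝ} (hL : 0 ≤ L) (t : ℝ) (v : Vertex (m + 1) → ℝ) {k R : ℕ}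
    (hk : k ≤ R) (i : Fin (m + 1)) {s : ℤ} (hs : s.natAbs ≤ R) :
    sobolevSum t L (fun z => v (slice i s z)) (box 0 k) ≤ slab t L v R i s.natAbs := by
  have hinj : Function.Injective (slice i s) := Fin.insertNth_right_injective (α := fun _ => ℤ) s
  let sliceBond : Bond m → Bond (m + 1) := fun e => (slice i s e.1, i.succAbove e.2)
  have hbond_inj : Function.Injective sliceBond :=
    hinj.prodMap (Fin.succAbove_right_injective (p := i))
  have hupper : ∀ e, upper (sliceBond e) = slice i s (upper e) := fun e =>
    (slice_add_single i s e.1 e.2).symm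
  have hgrad : ∀ e, grad (fun z => v (slice i s z)) e = grad v (sliceBond e) := fun e => by
    simp only [grad, hupper]
    rfl
  simp only [sobolevSum, slab, hgrad]
  rw [← Finset.sum_image (f := fun e => |grad v e| ^ t) hbond_inj.injOn,
    ← Finset.sum_image (f := fun x => |v x| ^ t) hinj.injOn]
  gcongr
  · refine Finset.image_subset_iff.2 fun e he => ?_
    rw [mem_bondsIn] at he
    rw [Finset.mem_filter, mem_bondsIn, hupper]
    exact ⟨⟨slice_mem_box hs hk he.1, slice_mem_box hs hk he.2⟩, by simp [sliceBond, lower]⟩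
  · refine Finset.image_subset_iff.2 fun z hz => ?_
    rw [Finset.mem_filter]
    exact ⟨slice_mem_box hs hk hz, by simp⟩

theorem lower_apply_of_mem_layer {d k : ℕ} {e : Bond d} (he : e ∈ layer d k) :
    (lower e e.2 = k ∨ lower e e.2 = -(k + 1)) ∧ ∀ j ≠ e.2, (lower e j).natAbs ≤ k := by
  have hsame : upper e e.2 = lower e e.2 + 1 := by simp [upper, lower]
  have hne : ∀ j ≠ e.2, upper e j = lower e j := fun j hj => by simp [upper, lower, hj]
  have hother : ∀ j ≠ e.2, (lower e j).natAbs ≤ k := fun j hj => by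
    have hl := natAbs_le_radius (lower e) j
    have hu := natAbs_le_radius (upper e) j
    rw [hne j hj] at hu
    rcases mem_layer.1 he with h | h <;> omega
  have hattained : ∀ x : Vertex d, radius x = k + 1 → (∀ j ≠ e.2, (x j).natAbs ≤ k) →
      k < (x e.2).natAbs := fun x hx hxj => by
    by_contra! hle
    have : radius x ≤ k := radius_le_iff.2 fun j => by
      by_cases hj : j = e.2
      · exact hj ▸ hle
      · exact hxj j hj
    omega
  refine ⟨?_, hother⟩
  rcases mem_layer.1 he with ⟨hl, hu⟩ | ⟨hl, hu⟩
  · have := natAbs_le_radius (lower e) e.2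
    have := hattained _ hu fun j hj => (hne j hj).symm ▸ hother j hj
    omega
  · have := natAbs_le_radius (upper e) e.2
    have := hattained _ hl hother
    omega

theorem sum_layer_le_sum_slice {f : Bond (m + 1) → ℝ} (hf : ∀ e, 0 ≤ f e) (k : ℕ) :
    ∑ e ∈ layer (m + 1) k, f e ≤
      ∑ i, ∑ s ∈ {(k : ℤ), -(k + 1 : ℤ)}, ∑ z ∈ box (0 : Vertex m) k, f (slice i s z, i) := by
  let toBond : Fin (m + 1) × ℤ × Vertex m → Bond (m + 1) := fun y => (slice y.1 y.2.1 y.2.2, y.1)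
  have hsub : layer (m + 1) k ⊆
      (Finset.univ ×ˢ {(k : ℤ), -(k + 1 : ℤ)} ×ˢ box 0 k).image toBond := fun e he => by
    obtain ⟨hs, hz⟩ := lower_apply_of_mem_layer he
    refine Finset.mem_image.2 ⟨(e.2, e.1 e.2, e.2.removeNth e.1), ?_, ?_⟩
    · simp only [Finset.mem_product, Finset.mem_univ, Finset.mem_insert, Finset.mem_singleton,
        mem_box_zero_iff_radius, radius_le_iff, true_and]
      exact ⟨hs, fun j => hz _ (Fin.succAbove_ne _ _)⟩
    · exact Prod.ext (Fin.insertNth_self_removeNth (α := fun _ => ℤ) _ _) rfl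
  calc ∑ e ∈ layer (m + 1) k, f e
      ≤ ∑ e ∈ (Finset.univ ×ˢ {(k : ℤ), -(k + 1 : ℤ)} ×ˢ box 0 k).image toBond, f e :=
        Finset.sum_le_sum_of_subset_of_nonneg hsub fun e _ _ => hf e
    _ ≤ ∑ y ∈ Finset.univ ×ˢ {(k : ℤ), -(k + 1 : ℤ)} ×ˢ box 0 k, f (toBond y) :=
        Finset.sum_image_le_of_nonneg fun e _ => hf e
    _ = _ := by simp only [Finset.sum_product, toBond]

theorem sobolev_layer (hm : 2 ≤ m) {t T : ℝ} (ht : 1 ≤ t) (hT : 0 < T)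
    (htT : 1 / T = 1 / t - 1 / m) :
    ∃ C : ℝ, 0 ≤ C ∧ ∀ (k R : ℕ) (L : ℝ), k < R → 0 < L → L ≤ 2 * k + 1 →
      ∀ v : Vertex (m + 1) → ℝ, (∀ x, 0 ≤ v x) →
        ∑ e ∈ layer (m + 1) k, bondMax v e ^ T ≤ C * layerEnergy t L v R k ^ (T / t) := by
  obtain ⟨C, hC, hbox⟩ := sobolev_box hm ht hT htT
  refine ⟨4 * (m + 1) * C, by positivity, fun k R L hk hL hLk v hv => ?_⟩
  have hface : ∀ (i : Fin (m + 1)) (s : ℤ), (s.natAbs = k ∨ s.natAbs = k + 1) →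
      ∑ z ∈ box (0 : Vertex m) k, v (slice i s z) ^ T ≤ C * layerEnergy t L v R k ^ (T / t) :=
    fun i s hs => by
      have hsR : s.natAbs ≤ R := by omega
      refine (hbox k L hL hLk (fun z => v (slice i s z)) fun z => hv _).trans ?_
      gcongr
      · exact sobolevSum_nonneg hL.le _ _ _
      · exact (sobolevSum_slice_le hL.le t v hk.le i hsR).trans
          (slab_le_layerEnergy hL.le t v R k i hs)
  have hbond : ∀ (i : Fin (m + 1)) (s : ℤ) (z : Vertex m),
      bondMax v (slice i s z, i) ^ T ≤ v (slice i s z) ^ T + v (slice i (s + 1) z) ^ T :=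
    fun i s z => by
      have hupper : upper (slice i s z, i) = slice i (s + 1) z := by
        ext l
        rcases Fin.eq_self_or_eq_succAbove i l with rfl | ⟨l, rfl⟩ <;> simp [upper]
      rw [← bondMax_rpow hv hT.le, bondMax, hupper]
      exact max_le_add_of_nonneg (Real.rpow_nonneg (hv _) T) (Real.rpow_nonneg (hv _) T)
  have hsum : ∀ (i : Fin (m + 1)) (s : ℤ), s = k ∨ s = -(k + 1 : ℤ) →
      ∑ z ∈ box (0 : Vertex m) k, bondMax v (slice i s z, i) ^ T ≤
        2 * (C * layerEnergy t L v R k ^ (T / t)) := fun i s hs => by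
    refine (Finset.sum_le_sum fun z _ => hbond i s z).trans ?_
    rw [Finset.sum_add_distrib, two_mul]
    exact add_le_add (hface i s (by omega)) (hface i (s + 1) (by omega))
  calc ∑ e ∈ layer (m + 1) k, bondMax v e ^ T
      ≤ ∑ i, ∑ s ∈ {(k : ℤ), -(k + 1 : ℤ)}, ∑ z ∈ box (0 : Vertex m) k,
          bondMax v (slice i s z, i) ^ T :=
        sum_layer_le_sum_slice (fun e => Real.rpow_nonneg (bondMax_nonneg hv e) T) k
    _ ≤ ∑ _i : Fin (m + 1), 4 * (C * layerEnergy t L v R k ^ (T / t)) := by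
        refine Finset.sum_le_sum fun i _ => ?_
        rw [Finset.sum_pair (by omega)]
        linarith [hsum i k (Or.inl rfl), hsum i (-(k + 1 : ℤ)) (Or.inr rfl)]
    _ = _ := by
        rw [Finset.sum_const, Finset.card_univ, Fintype.card_fin, nsmul_eq_mul]
        push_cast
        ring

end Slice

/-! ### Energy estimate with an optimised cutoff -/

section AvgNorm

variable {ι : Type*} {p : ℝ≥0∞}

theorem avgNorm_nonneg (p : ℝ≥0∞) (S : Finset ι) (f : ι → ℝ) : 0 ≤ avgNorm p S f := by
  unfold avgNorm
  split_ifs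
  · exact Real.iSup_nonneg fun _ => abs_nonneg _
  · positivity

theorem abs_le_avgNorm_top {S : Finset ι} {f : ι → ℝ} {x : ι} (hx : x ∈ S) :
    |f x| ≤ avgNorm ∞ S f := by
  rw [avgNorm, if_pos rfl]
  exact le_ciSup (f := fun x : S => |f x|) (Set.finite_range _).bddAbove ⟨x, hx⟩

theorem avgNorm_top_mono {S T : Finset ι} (hTS : T ⊆ S) (f : ι → ℝ) :
    avgNorm ∞ T f ≤ avgNorm ∞ S f := by
  rw [avgNorm, if_pos rfl]
  exact Real.iSup_le (fun x => abs_le_avgNorm_top (hTS x.2)) (avgNorm_nonneg _ _ _)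

theorem card_mul_avgNorm_rpow (hp₀ : p ≠ 0) (hp : p ≠ ∞) (S : Finset ι) (f : ι → ℝ) :
    S.card * avgNorm p S f ^ p.toReal = ∑ x ∈ S, |f x| ^ p.toReal := by
  have hp' : p.toReal ≠ 0 := (ENNReal.toReal_pos hp₀ hp).ne'
  rw [avgNorm, if_neg hp, ← Real.rpow_mul (by positivity), one_div_mul_cancel hp', Real.rpow_one]
  rcases S.eq_empty_or_nonempty with rfl | hS
  · simp
  · exact mul_inv_cancel_left₀ (by exact_mod_cast hS.card_ne_zero) _

theorem sum_card_mul_avgNorm_rpow_le {κ : Type*} (hp₀ : p ≠ 0) {S : Finset ι} {I : Finset κ}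
    {T : κ → Finset ι} (hT : ∀ k ∈ I, T k ⊆ S) (hdisj : Pairwise (Function.onFun Disjoint T))
    (f : ι → ℝ) :
    ∑ k ∈ I, (T k).card * avgNorm p (T k) f ^ p.toReal ≤ S.card * avgNorm p S f ^ p.toReal := by
  classical
  have hdisj' : Set.PairwiseDisjoint (I : Set κ) T := fun k _ l _ hkl => hdisj hkl
  have hunion : I.biUnion T ⊆ S := Finset.biUnion_subset.2 hT
  rcases eq_or_ne p ∞ with rfl | hp
  · simp only [ENNReal.toReal_top, Real.rpow_zero, mul_one]
    rw [← Nat.cast_sum, ← Finset.card_biUnion hdisj']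
    exact_mod_cast Finset.card_le_card hunion
  · simp only [card_mul_avgNorm_rpow hp₀ hp]
    rw [← Finset.sum_biUnion hdisj']
    exact Finset.sum_le_sum_of_subset_of_nonneg hunion fun _ _ _ => by positivity

theorem card_rpow_mul_avgNorm_le (hp₀ : p ≠ 0) {S T : Finset ι} (hTS : T ⊆ S) {f : ι → ℝ} {μ : ℝ}
    (hμ : 0 ≤ μ)
    (h : T.card * avgNorm p T f ^ p.toReal ≤ μ * (S.card * avgNorm p S f ^ p.toReal)) :
    (T.card : ℝ) ^ (p⁻¹).toReal * avgNorm p T f ≤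
      (μ * S.card) ^ (p⁻¹).toReal * avgNorm p S f := by
  have hS := avgNorm_nonneg p S f
  have hT := avgNorm_nonneg p T f
  rcases eq_or_ne p ∞ with rfl | hp
  · simpa using avgNorm_top_mono hTS f
  · have hpos := ENNReal.toReal_pos hp₀ hp
    rw [← mul_assoc] at h
    have hroot := Real.rpow_le_rpow (by positivity) h (inv_nonneg.2 hpos.le)
    rwa [Real.mul_rpow (by positivity) (by positivity), Real.rpow_rpow_inv hT hpos.ne',
      Real.mul_rpow (by positivity) (by positivity), Real.rpow_rpow_inv hS hpos.ne',
      ← ENNReal.toReal_inv] at hroot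

theorem inv_toReal_le_one (hp : 1 ≤ p) : (p⁻¹).toReal ≤ 1 :=
  ENNReal.toReal_le_of_le_ofReal zero_le_one (by simpa using hp)

theorem inv_toReal_lt_one (hp : 1 < p) : (p⁻¹).toReal < 1 :=
  (inv_toReal_le_one hp.le).lt_of_ne fun h => by
    have hp' : p⁻¹ = 1 := (ENNReal.toReal_eq_one_iff _).1 h
    exact hp.ne' (by simpa using hp')

theorem sum_mul_rpow_le_avgNorm (hp : 1 ≤ p) {S T : Finset ι} (hTS : T ⊆ S) {f g : ι → ℝ}
    (hf : ∀ x, 0 ≤ f x) (hg : ∀ x, 0 ≤ g x) :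
    ∑ x ∈ T, f x * g x ^ (1 - (p⁻¹).toReal) ≤
      (S.card : ℝ) ^ (p⁻¹).toReal * avgNorm p S f * (∑ x ∈ T, g x) ^ (1 - (p⁻¹).toReal) := by
  rcases eq_or_ne p ∞ with rfl | hp_top
  · simp only [ENNReal.inv_top, ENNReal.toReal_zero, sub_zero, Real.rpow_zero, one_mul,
      Real.rpow_one, Finset.mul_sum]
    exact Finset.sum_le_sum fun x hx => mul_le_mul_of_nonneg_right
      ((le_abs_self _).trans (abs_le_avgNorm_top (hTS hx))) (hg x)
  have hp₀ : p ≠ 0 := (zero_lt_one.trans_le hp).ne'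
  have hpos := ENNReal.toReal_pos hp₀ hp_top
  have hfp : ∀ x, 0 ≤ f x ^ p.toReal := fun x => Real.rpow_nonneg (hf x) _
  have hmass : ∑ x ∈ T, f x ^ p.toReal ≤ S.card * avgNorm p S f ^ p.toReal := by
    simp only [card_mul_avgNorm_rpow hp₀ hp_top, abs_of_nonneg (hf _)]
    exact Finset.sum_le_sum_of_subset_of_nonneg hTS fun x _ _ => hfp x
  have hholder := sum_rpow_mul_rpow_le T (sub_nonneg.2 (inv_toReal_le_one hp))
    (sub_le_self 1 ENNReal.toReal_nonneg) (fun x _ => hfp x) fun x _ => hg x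
  simp only [sub_sub_cancel, ENNReal.toReal_inv, Real.rpow_rpow_inv (hf _) hpos.ne'] at hholder ⊢
  refine hholder.trans (mul_le_mul_of_nonneg_right ?_
    (Real.rpow_nonneg (Finset.sum_nonneg fun x _ => hg x) _))
  refine (Real.rpow_le_rpow (Finset.sum_nonneg fun x _ => hfp x) hmass (by positivity)).trans_eq ?_
  have hS := avgNorm_nonneg p S f
  rw [Real.mul_rpow (by positivity) (by positivity), Real.rpow_rpow_inv hS hpos.ne']

end AvgNorm

section GoodIndices

variable {ι : Type*} {I : Finset ι}

theorem four_mul_card_filter_le {X : ι → ℝ} {A : ℝ} (hX : ∀ k, 0 ≤ X k)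
    (hA : ∑ k ∈ I, X k ≤ A) : 4 * (I.filter fun k => 4 * A / I.card < X k).card ≤ I.card := by
  set J := I.filter fun k => 4 * A / I.card < X k
  by_contra! hlt
  have hJ : J.Nonempty := Finset.card_pos.1 (by omega)
  have hI : (0 : ℝ) < I.card := by exact_mod_cast (hJ.mono (Finset.filter_subset _ _)).card_pos
  have hsum : J.card * (4 * A / I.card) < A := calc
    J.card * (4 * A / I.card) = ∑ _k ∈ J, 4 * A / I.card := by rw [Finset.sum_const, nsmul_eq_mul]
    _ < ∑ k ∈ J, X k := Finset.sum_lt_sum_of_nonempty hJ fun k hk => (Finset.mem_filter.1 hk).2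
    _ ≤ ∑ k ∈ I, X k :=
      Finset.sum_le_sum_of_subset_of_nonneg (Finset.filter_subset _ _) fun k _ _ => hX k
    _ ≤ A := hA
  rw [← mul_div_assoc, div_lt_iff₀ hI] at hsum
  have hA₀ : 0 ≤ A := (Finset.sum_nonneg fun k _ => hX k).trans hA
  have : (I.card : ℝ) < 4 * J.card := by exact_mod_cast hlt
  nlinarith

theorem exists_subset_le_four_mul_average {X Y : ι → ℝ} {A B : ℝ} (hX : ∀ k, 0 ≤ X k)
    (hY : ∀ k, 0 ≤ Y k) (hA : ∑ k ∈ I, X k ≤ A) (hB : ∑ k ∈ I, Y k ≤ B) :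
    ∃ G ⊆ I, I.card ≤ 2 * G.card ∧ ∀ k ∈ G, X k ≤ 4 * A / I.card ∧ Y k ≤ 4 * B / I.card := by
  classical
  refine ⟨I.filter fun k => X k ≤ 4 * A / I.card ∧ Y k ≤ 4 * B / I.card,
    Finset.filter_subset _ _, ?_, fun k hk => (Finset.mem_filter.1 hk).2⟩
  have hbad := (Finset.card_union_le _ _).trans (add_le_add
    (le_refl (I.filter fun k => 4 * A / I.card < X k).card)
    (le_refl (I.filter fun k => 4 * B / I.card < Y k).card))
  have hsplit := Finset.card_filter_add_card_filter_not (s := I)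
    fun k => X k ≤ 4 * A / I.card ∧ Y k ≤ 4 * B / I.card
  simp only [not_and_or, not_le, Finset.filter_or] at hsplit
  have := four_mul_card_filter_le hX hA
  have := four_mul_card_filter_le hY hB
  omega

end GoodIndices

theorem card_box_le (d : ℕ) {n : ℕ} (hn : 1 ≤ n) :
    ((box (0 : Vertex d) (4 * n)).card : ℝ) ≤ 9 ^ d * (n : ℝ) ^ d := by
  have hcard : (box (0 : Vertex d) (4 * n)).card = (8 * n + 1) ^ d := by
    simp only [box, Fintype.card_piFinset, Pi.zero_apply, Int.card_Icc, Finset.prod_const,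
      Finset.card_univ, Fintype.card_fin]
    congr 1
    omega
  rw [← mul_pow]
  exact_mod_cast hcard.trans_le (Nat.pow_le_pow_left (by omega) d)

theorem card_bondsIn_le {d : ℕ} (S : Finset (Vertex d)) :
    ((bondsIn S).card : ℝ) ≤ d * S.card := by
  have : (bondsIn S).card ≤ (S ×ˢ (Finset.univ : Finset (Fin d))).card :=
    Finset.card_filter_le _ _
  rw [Finset.card_product, Finset.card_univ, Fintype.card_fin, mul_comm] at this
  exact_mod_cast this

theorem card_bondsIn_box_le (d : ℕ) {n : ℕ} (hn : 1 ≤ n) :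
    ((bondsIn (box (0 : Vertex d) (4 * n))).card : ℝ) ≤ d * 9 ^ d * (n : ℝ) ^ d := calc
  _ ≤ (d : ℝ) * (box (0 : Vertex d) (4 * n)).card := card_bondsIn_le _
  _ ≤ d * (9 ^ d * (n : ℝ) ^ d) := by
    gcongr
    exact card_box_le d hn
  _ = _ := by ring

section Energy

variable {m : ℕ} {p : ℝ≥0∞} {t : ℝ}

theorem sum_layer_mul_sq_le (hm : 2 ≤ m) (hp : 1 < p) (ht : 1 ≤ t)
    (htp : 1 / t = (1 - (p⁻¹).toReal) / 2 + 1 / m) :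
    ∃ C : ℝ, 0 ≤ C ∧ ∀ (k R : ℕ) (L : ℝ), k < R → 0 < L → L ≤ 2 * k + 1 →
      ∀ ω : Bond (m + 1) → ℝ, (∀ e, 0 < ω e) → ∀ v : Vertex (m + 1) → ℝ, (∀ x, 0 ≤ v x) →
        ∑ e ∈ layer (m + 1) k, ω e * bondMax v e ^ 2 ≤
          C * (((layer (m + 1) k).card : ℝ) ^ (p⁻¹).toReal * avgNorm p (layer (m + 1) k) ω) *
            layerEnergy t L v R k ^ (2 / t) := by
  have hθ : 0 < 1 - (p⁻¹).toReal := sub_pos.2 (inv_toReal_lt_one hp)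
  set θ := 1 - (p⁻¹).toReal with hθ_def
  obtain ⟨C, hC, hsob⟩ := sobolev_layer hm ht (div_pos two_pos hθ) (T := 2 / θ)
    (by rw [htp, one_div_div]; ring)
  refine ⟨C ^ θ, by positivity, fun k R L hk hL hLk ω hω v hv => ?_⟩
  have hmax := bondMax_nonneg hv
  have hsq : ∀ e, (bondMax v e ^ (2 / θ)) ^ θ = bondMax v e ^ 2 := fun e => by
    rw [← Real.rpow_mul (hmax e), div_mul_cancel₀ _ hθ.ne', Real.rpow_two]
  have hE := layerEnergy_nonneg hL.le t v R k
  have hholder := sum_mul_rpow_le_avgNorm hp.le (Finset.Subset.refl (layer (m + 1) k))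
    (fun e => (hω e).le) fun e => Real.rpow_nonneg (hmax e) (2 / θ)
  simp only [← hθ_def, hsq] at hholder
  calc ∑ e ∈ layer (m + 1) k, ω e * bondMax v e ^ 2
      ≤ ((layer (m + 1) k).card : ℝ) ^ (p⁻¹).toReal * avgNorm p (layer (m + 1) k) ω *
          (∑ e ∈ layer (m + 1) k, bondMax v e ^ (2 / θ)) ^ θ := hholder
    _ ≤ ((layer (m + 1) k).card : ℝ) ^ (p⁻¹).toReal * avgNorm p (layer (m + 1) k) ω *
          (C * layerEnergy t L v R k ^ (2 / θ / t)) ^ θ := by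
        have := avgNorm_nonneg p (layer (m + 1) k) ω
        have := Finset.sum_nonneg fun e (_ : e ∈ layer (m + 1) k) =>
          Real.rpow_nonneg (hmax e) (2 / θ)
        gcongr
        exact hsob k R L hk hL hLk v hv
    _ = _ := by
        have hexp : 2 / θ / t * θ = 2 / t := by field_simp
        rw [Real.mul_rpow hC (by positivity), ← Real.rpow_mul hE, hexp]
        ring

theorem exists_layers_sum_mul_sq_le (hm : 2 ≤ m) (hp : 1 < p) (ht : 1 ≤ t)
    (htp : 1 / t = (1 - (p⁻¹).toReal) / 2 + 1 / m) :
    ∃ C : ℝ, 0 ≤ C ∧ ∀ ω : Bond (m + 1) → ℝ, (∀ e, 0 < ω e) → ∀ v : Vertex (m + 1) → ℝ,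
      (∀ x, 0 ≤ v x) → ∀ n ρ σ : ℕ, 1 ≤ n → n ≤ ρ → ρ < σ → σ ≤ 4 * n →
        ∃ G ⊆ Finset.Ico ρ σ, (σ - ρ : ℝ) ≤ 2 * G.card ∧ ∀ k ∈ G,
          ∑ e ∈ layer (m + 1) k, ω e * bondMax v e ^ 2 ≤
            C * (((n : ℝ) ^ (m + 1) / (σ - ρ)) ^ (p⁻¹).toReal *
              avgNorm p (bondsIn (box 0 (4 * n))) ω) *
              (sobolevSum t n v (box 0 σ) / (σ - ρ)) ^ (2 / t) := by
  obtain ⟨C, hC, hlayer⟩ := sum_layer_mul_sq_le hm hp ht htp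
  have hp₀ : p ≠ 0 := (zero_lt_one.trans hp).ne'
  set a := (p⁻¹).toReal
  have ha : 0 ≤ a := ENNReal.toReal_nonneg
  set D : ℝ := ((m + 1 : ℕ) : ℝ)
  refine ⟨C * (4 * (D * 9 ^ (m + 1))) ^ a * (8 * D) ^ (2 / t), by positivity,
    fun ω hω v hv n ρ σ hn hnρ hρσ hσ => ?_⟩
  set S := bondsIn (box (0 : Vertex (m + 1)) (4 * n))
  have hN : (0 : ℝ) < σ - ρ := sub_pos.2 (by exact_mod_cast hρσ)
  have hIN : ((Finset.Ico ρ σ).card : ℝ) = σ - ρ := by rw [Nat.card_Ico, Nat.cast_sub hρσ.le]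
  have hn₀ : (0 : ℝ) < n := by exact_mod_cast hn
  have hE := sobolevSum_nonneg hn₀.le t v (box 0 σ)
  have hω_avg := avgNorm_nonneg p S ω
  have hsub : ∀ k ∈ Finset.Ico ρ σ, layer (m + 1) k ⊆ S := fun k hk =>
    layer_subset ((Finset.mem_Ico.1 hk).2.trans_le hσ)
  obtain ⟨G, hGI, hGcard, hG⟩ := exists_subset_le_four_mul_average
    (fun k => mul_nonneg (Nat.cast_nonneg _) (Real.rpow_nonneg (avgNorm_nonneg _ _ _) _))
    (fun k => layerEnergy_nonneg hn₀.le t v σ k)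
    (sum_card_mul_avgNorm_rpow_le hp₀ hsub (pairwise_disjoint_layer _) ω)
    (sum_layerEnergy_le hn₀.le t v σ _)
  rw [hIN] at hG
  refine ⟨G, hGI, hIN ▸ (by exact_mod_cast hGcard), fun k hk => ?_⟩
  have hk' := Finset.mem_Ico.1 (hGI hk)
  have hnk : (n : ℝ) ≤ k := by exact_mod_cast hnρ.trans hk'.1
  have hmass := card_rpow_mul_avgNorm_le hp₀ (hsub k (hGI hk)) (f := ω) (μ := 4 / (σ - ρ))
    (by positivity) ((hG k hk).1.trans_eq (by ring))
  have hcard : 4 / (σ - ρ) * S.card ≤ 4 * (D * 9 ^ (m + 1)) * ((n : ℝ) ^ (m + 1) / (σ - ρ)) :=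
    (mul_le_mul_of_nonneg_left (card_bondsIn_box_le _ hn) (by positivity)).trans_eq (by ring)
  have henergy := (hG k hk).2.trans_eq
    (mul_div_assoc 4 _ _ |>.trans (by ring) :
      _ = 8 * D * (sobolevSum t n v (box 0 σ) / (σ - ρ)))
  have hlayer_nonneg := layerEnergy_nonneg hn₀.le t v σ k
  calc ∑ e ∈ layer (m + 1) k, ω e * bondMax v e ^ 2
      ≤ C * (((layer (m + 1) k).card : ℝ) ^ a * avgNorm p (layer (m + 1) k) ω) *
          layerEnergy t n v σ k ^ (2 / t) :=
        hlayer k σ n hk'.2 hn₀ (by linarith) ω hω v hv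
    _ ≤ C * ((4 * (D * 9 ^ (m + 1)) * ((n : ℝ) ^ (m + 1) / (σ - ρ))) ^ a * avgNorm p S ω) *
          (8 * D * (sobolevSum t n v (box 0 σ) / (σ - ρ))) ^ (2 / t) := by
        refine mul_le_mul (mul_le_mul_of_nonneg_left (hmass.trans ?_) hC)
          (Real.rpow_le_rpow hlayer_nonneg henergy (by positivity)) (by positivity) (by positivity)
        gcongr
    _ = _ := by
        rw [Real.mul_rpow (x := 8 * D) (by positivity) (by positivity),
          Real.mul_rpow (x := 4 * (D * 9 ^ (m + 1))) (by positivity) (by positivity)]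
        ring

theorem energy_le_sobolevSum (hm : 2 ≤ m) (hp : 1 < p) (ht : 1 ≤ t)
    (htp : 1 / t = (1 - (p⁻¹).toReal) / 2 + 1 / m) :
    ∃ C : ℝ, 0 ≤ C ∧ ∀ ω : Bond (m + 1) → ℝ, (∀ e, 0 < ω e) → ∀ (u : Vertex (m + 1) → ℝ) (α : ℝ),
      1 ≤ α → ∀ n ρ σ : ℕ, 1 ≤ n → n ≤ ρ → ρ < σ → σ ≤ 4 * n → IsHarmonicWithin ω σ u →
        ∑ e ∈ bondsIn (box 0 ρ), ω e * grad (fun x => |u x| ^ α) e ^ 2 ≤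
          C * α * avgNorm p (bondsIn (box 0 (4 * n))) ω *
            ((n : ℝ) ^ (m + 1) / (σ - ρ)) ^ (p⁻¹).toReal * (1 / (σ - ρ)) *
            (sobolevSum t n (fun x => |u x| ^ α) (box 0 σ) / (σ - ρ)) ^ (2 / t) := by
  obtain ⟨C, hC, hlayers⟩ := exists_layers_sum_mul_sq_le hm hp ht htp
  refine ⟨12 * C, by positivity, fun ω hω u α hα n ρ σ hn hnρ hρσ hσ hu => ?_⟩
  have hN : (0 : ℝ) < σ - ρ := sub_pos.2 (by exact_mod_cast hρσ)
  obtain ⟨G, hGI, hGcard, hG⟩ := hlayers ω hω (fun x => |u x| ^ α)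
    (fun x => Real.rpow_nonneg (abs_nonneg _) _) n ρ σ hn hnρ hρσ hσ
  set v : Vertex (m + 1) → ℝ := fun x => |u x| ^ α
  set Q : ℝ := C * (((n : ℝ) ^ (m + 1) / (σ - ρ)) ^ (p⁻¹).toReal *
    avgNorm p (bondsIn (box 0 (4 * n))) ω) * (sobolevSum t n v (box 0 σ) / (σ - ρ)) ^ (2 / t)
  have hQ : 0 ≤ Q := by
    have := avgNorm_nonneg p (bondsIn (box 0 (4 * n))) ω
    have := sobolevSum_nonneg n.cast_nonneg t v (box 0 σ)
    positivity
  have hGpos : (0 : ℝ) < G.card := by linarith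
  calc ∑ e ∈ bondsIn (box 0 ρ), ω e * grad v e ^ 2
      ≤ 6 * α * ((G.card : ℝ)⁻¹ ^ 2 * ∑ k ∈ G, ∑ e ∈ layer (m + 1) k, ω e * bondMax v e ^ 2) :=
        caccioppoli_layers hω hu hα hρσ.le hGI (Finset.card_pos.1 (by exact_mod_cast hGpos))
    _ ≤ 6 * α * ((G.card : ℝ)⁻¹ ^ 2 * (G.card * Q)) := by
        gcongr
        exact (Finset.sum_le_sum hG).trans_eq (by rw [Finset.sum_const, nsmul_eq_mul])
    _ = 6 * α * ((G.card : ℝ)⁻¹ * Q) := by field_simp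
    _ ≤ 6 * α * (((σ - ρ : ℝ) / 2)⁻¹ * Q) := by
        gcongr
        linarith
    _ = _ := by
        simp only [Q]
        rw [inv_div]
        ring

end Energy

/-! ### Scaled norms on boxes -/

/-- The normalized `L^t` norm of the gradient of `v` on `B(R)`, times the length scale `n`. The
normalization is by `n ^ d`, which is comparable to the number of bonds when `n ≤ R ≤ 4 * n` and
does not change with `R`. -/
noncomputable def gradNorm {d : ℕ} (t : ℝ) (n : ℕ) (v : Vertex d → ℝ) (R : ℕ) : ℝ :=
  n * (((n : ℝ) ^ d)⁻¹ * ∑ e ∈ bondsIn (box 0 R), |grad v e| ^ t) ^ (1 / t)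

/-- The `L^t` norm of `v` on `B(R)`, normalized by `n ^ d` like `gradNorm`. -/
noncomputable def boxNorm {d : ℕ} (t : ℝ) (n : ℕ) (v : Vertex d → ℝ) (R : ℕ) : ℝ :=
  (((n : ℝ) ^ d)⁻¹ * ∑ x ∈ box 0 R, |v x| ^ t) ^ (1 / t)

/-- The first order Sobolev norm of `v` on `B(R)`, scaled like `gradNorm`; it is the `ℓ^t`
combination of `gradNorm` and `boxNorm`. -/
noncomputable def sobolevNorm {d : ℕ} (t : ℝ) (n : ℕ) (v : Vertex d → ℝ) (R : ℕ) : ℝ :=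
  n * (((n : ℝ) ^ d)⁻¹ * sobolevSum t n v (box 0 R)) ^ (1 / t)

section ScaledNorms

variable {d n R : ℕ} {s t : ℝ} (v : Vertex d → ℝ)

theorem gradNorm_nonneg : 0 ≤ gradNorm t n v R := by
  unfold gradNorm
  positivity

theorem boxNorm_nonneg : 0 ≤ boxNorm t n v R := by
  unfold boxNorm
  positivity

theorem sobolevNorm_nonneg : 0 ≤ sobolevNorm t n v R := by
  have := sobolevSum_nonneg n.cast_nonneg t v (box 0 R)
  unfold sobolevNorm
  positivity

theorem natCast_mul_rpow_neg_mul_rpow (hn : 1 ≤ n) (ht : 0 < t) {x : ℝ} (hx : 0 ≤ x) :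
    (n : ℝ) * ((n : ℝ) ^ (-t) * x) ^ (1 / t) = x ^ (1 / t) := by
  have hn₀ : (0 : ℝ) < n := by exact_mod_cast hn
  have hexp : -t * (1 / t) = -1 := by field_simp
  rw [Real.mul_rpow (by positivity) hx, ← Real.rpow_mul hn₀.le, hexp, Real.rpow_neg_one,
    mul_inv_cancel_left₀ hn₀.ne']

theorem sobolevNorm_le_add (hn : 1 ≤ n) (ht : 1 ≤ t) :
    sobolevNorm t n v R ≤ gradNorm t n v R + boxNorm t n v R := by
  have ht₀ : 0 < t := by linarith
  rw [sobolevNorm, gradNorm, boxNorm, sobolevSum, mul_add]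
  calc _ ≤ (n : ℝ) * ((((n : ℝ) ^ d)⁻¹ * ∑ e ∈ bondsIn (box 0 R), |grad v e| ^ t) ^ (1 / t) +
        (((n : ℝ) ^ d)⁻¹ * ((n : ℝ) ^ (-t) * ∑ x ∈ box 0 R, |v x| ^ t)) ^ (1 / t)) := by
        gcongr
        exact Real.rpow_add_le_add_rpow (by positivity) (by positivity) (by positivity)
          ((div_le_one ht₀).2 ht)
    _ = _ := by
        rw [mul_add, mul_left_comm _ ((n : ℝ) ^ (-t)),
          natCast_mul_rpow_neg_mul_rpow hn ht₀ (by positivity)]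

theorem boxNorm_le_sobolevNorm (hn : 1 ≤ n) (ht : 0 < t) :
    boxNorm t n v R ≤ sobolevNorm t n v R := by
  rw [sobolevNorm, boxNorm, sobolevSum,
    ← natCast_mul_rpow_neg_mul_rpow hn ht (x := ((n : ℝ) ^ d)⁻¹ * _) (by positivity),
    mul_left_comm ((n : ℝ) ^ (-t))]
  gcongr
  exact le_add_of_nonneg_left (by positivity)

theorem sobolevNorm_mono (ht : 0 < t) {R' : ℕ} (hR : R ≤ R') :
    sobolevNorm t n v R ≤ sobolevNorm t n v R' := by
  have hbox : box (0 : Vertex d) R ⊆ box 0 R' := box_zero_mono hR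
  have hbonds := bondsIn_mono hbox
  have hsum : sobolevSum t n v (box 0 R) ≤ sobolevSum t n v (box 0 R') := by
    simp only [sobolevSum]
    gcongr
  have hsum₀ := sobolevSum_nonneg n.cast_nonneg t v (box 0 R)
  have hmean : ((n : ℝ) ^ d)⁻¹ * sobolevSum t n v (box 0 R) ≤
      ((n : ℝ) ^ d)⁻¹ * sobolevSum t n v (box 0 R') :=
    mul_le_mul_of_nonneg_left hsum (by positivity)
  exact mul_le_mul_of_nonneg_left
    (Real.rpow_le_rpow (mul_nonneg (by positivity) hsum₀) hmean (by positivity)) n.cast_nonneg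

theorem sobolevSum_rpow (hn : 1 ≤ n) (s : ℝ) :
    sobolevSum t n v (box 0 R) ^ (s / t) =
      sobolevNorm t n v R ^ s * (n : ℝ) ^ (d * (s / t) - s) := by
  have hn₀ : (0 : ℝ) < n := by exact_mod_cast hn
  have hsum := sobolevSum_nonneg hn₀.le t v (box 0 R)
  have hscale : (n : ℝ) ^ s * (n : ℝ) ^ (-(d * (s / t))) * (n : ℝ) ^ (d * (s / t) - s) = 1 := by
    rw [← Real.rpow_add hn₀, ← Real.rpow_add hn₀]
    ring_nf
    exact Real.rpow_zero _
  rw [sobolevNorm, Real.mul_rpow hn₀.le (by positivity), ← Real.rpow_mul (by positivity),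
    Real.mul_rpow (by positivity) hsum, Real.inv_rpow (by positivity), ← Real.rpow_natCast,
    ← Real.rpow_mul hn₀.le, ← Real.rpow_neg hn₀.le, one_div_mul_eq_div]
  linear_combination -(sobolevSum t n v (box 0 R) ^ (s / t)) * hscale

theorem boxNorm_rpow_fun {w : Vertex d → ℝ} (hw : ∀ x, 0 ≤ w x) {β : ℝ} (hβ : 0 < β) :
    boxNorm t n (fun x => w x ^ β) R = boxNorm (β * t) n w R ^ β := by
  simp only [boxNorm, abs_of_nonneg (Real.rpow_nonneg (hw _) β), abs_of_nonneg (hw _),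
    ← Real.rpow_mul (hw _)]
  have hsum : 0 ≤ ∑ x ∈ box 0 R, w x ^ (β * t) :=
    Finset.sum_nonneg fun x _ => Real.rpow_nonneg (hw x) _
  rw [← Real.rpow_mul (by positivity)]
  congr 1
  rw [one_div_mul_eq_div, div_mul_cancel_left₀ hβ.ne', one_div]

theorem card_box_le_of_le (hn : 1 ≤ n) (hR : R ≤ 4 * n) :
    ((box (0 : Vertex d) R).card : ℝ) ≤ 9 ^ d * (n : ℝ) ^ d :=
  le_trans (by exact_mod_cast Finset.card_le_card (box_zero_mono hR)) (card_box_le d hn)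

theorem boxNorm_le_of_exponent_le (hs : 0 < s) (hst : s ≤ t) (hn : 1 ≤ n) (hR : R ≤ 4 * n) :
    boxNorm s n v R ≤ ((9 : ℝ) ^ d) ^ ((1 - s / t) / s) * boxNorm t n v R := by
  have ht : 0 < t := hs.trans_le hst
  have hθ : s / t ≤ 1 := (div_le_one ht).2 hst
  have hn₀ : (0 : ℝ) < (n : ℝ) ^ d := by
    have : 0 < n := hn
    positivity
  set N := (n : ℝ) ^ d
  have hholder : ∑ x ∈ box 0 R, |v x| ^ s ≤
      (9 ^ d * N) ^ (1 - s / t) * (∑ x ∈ box 0 R, |v x| ^ t) ^ (s / t) := by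
    have h := sum_rpow_mul_rpow_le (box (0 : Vertex d) R) (A := fun _ => 1)
      (B := fun x => |v x| ^ t) (by positivity) hθ (fun _ _ => zero_le_one)
      (fun x _ => by positivity)
    simp only [Real.one_rpow, one_mul, Finset.sum_const, nsmul_eq_mul, mul_one,
      ← Real.rpow_mul (abs_nonneg _), mul_div_cancel₀ s ht.ne'] at h
    have := sub_nonneg.2 hθ
    exact h.trans (by gcongr; exact card_box_le_of_le hn hR)
  have hscale : N⁻¹ * N ^ (1 - s / t) = N⁻¹ ^ (s / t) := by
    rw [Real.inv_rpow hn₀.le, ← Real.rpow_neg hn₀.le, ← Real.rpow_neg_one, ← Real.rpow_add hn₀]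
    ring_nf
  calc boxNorm s n v R
      ≤ (N⁻¹ * ((9 ^ d * N) ^ (1 - s / t) *
          (∑ x ∈ box 0 R, |v x| ^ t) ^ (s / t))) ^ (1 / s) := by
        unfold boxNorm
        gcongr
    _ = ((9 ^ d) ^ (1 - s / t) * (N⁻¹ * ∑ x ∈ box 0 R, |v x| ^ t) ^ (s / t)) ^ (1 / s) := by
        congr 1
        rw [Real.mul_rpow (by positivity) hn₀.le,
          Real.mul_rpow (inv_nonneg.2 hn₀.le) (by positivity), ← hscale]
        ring
    _ = _ := by
        rw [Real.mul_rpow (by positivity) (by positivity), ← Real.rpow_mul (by positivity),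
          ← Real.rpow_mul (by positivity), mul_one_div, div_mul_div_cancel₀' hs.ne', boxNorm]

theorem boxNorm_le_avgNorm {P : ℝ≥0∞} (hP₀ : P ≠ 0) (hP : P ≠ ∞) (hn : 1 ≤ n) (hR : R ≤ 4 * n) :
    boxNorm P.toReal n v R ≤
      ((9 : ℝ) ^ d) ^ (1 / P.toReal) * avgNorm P (box 0 (4 * n)) v := by
  have hpos := ENNReal.toReal_pos hP₀ hP
  have : (0 : ℝ) < n := by exact_mod_cast hn
  have hA := avgNorm_nonneg P (box 0 (4 * n)) v
  have hsum : ∑ x ∈ box 0 R, |v x| ^ P.toReal ≤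
      9 ^ d * (n : ℝ) ^ d * avgNorm P (box 0 (4 * n)) v ^ P.toReal := calc
    _ ≤ ∑ x ∈ box 0 (4 * n), |v x| ^ P.toReal :=
      Finset.sum_le_sum_of_subset_of_nonneg (box_zero_mono hR) fun _ _ _ => by positivity
    _ = (box (0 : Vertex d) (4 * n)).card * avgNorm P (box 0 (4 * n)) v ^ P.toReal :=
      (card_mul_avgNorm_rpow hP₀ hP _ v).symm
    _ ≤ _ := by
      gcongr
      exact card_box_le d hn
  calc boxNorm P.toReal n v R
      ≤ (((n : ℝ) ^ d)⁻¹ * (9 ^ d * (n : ℝ) ^ d * avgNorm P (box 0 (4 * n)) v ^ P.toReal)) ^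
          (1 / P.toReal) := by
        unfold boxNorm
        gcongr
    _ = (9 ^ d * avgNorm P (box 0 (4 * n)) v ^ P.toReal) ^ (1 / P.toReal) := by
        congr 1
        field_simp
    _ = _ := by
        rw [Real.mul_rpow (by positivity) (by positivity), ← Real.rpow_mul hA,
          mul_one_div_cancel hpos.ne', Real.rpow_one]

theorem abs_le_pow_mul_sobolevNorm (hn : 1 ≤ n) (ht : 1 ≤ t) {x : Vertex d} (hx : x ∈ box 0 R) :
    |v x| ≤ (n : ℝ) ^ d * sobolevNorm t n v R := by
  have hN : (1 : ℝ) ≤ (n : ℝ) ^ d := one_le_pow₀ (by exact_mod_cast hn)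
  have ht₀ : 0 < t := by linarith
  have hterm : |v x| ≤ (∑ y ∈ box 0 R, |v y| ^ t) ^ (1 / t) := calc
    |v x| = (|v x| ^ t) ^ (1 / t) := by
      rw [← Real.rpow_mul (abs_nonneg _), mul_one_div_cancel ht₀.ne', Real.rpow_one]
    _ ≤ _ := by
      gcongr
      exact Finset.single_le_sum (f := fun y => |v y| ^ t) (fun y _ => by positivity) hx
  have hfactor : 1 ≤ (n : ℝ) ^ d * (((n : ℝ) ^ d)⁻¹) ^ (1 / t) := by
    rw [Real.inv_rpow (by positivity), ← div_eq_mul_inv, one_le_div (by positivity)]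
    exact Real.rpow_le_self_of_one_le hN ((div_le_one ht₀).2 ht)
  calc |v x| ≤ (n : ℝ) ^ d * (((n : ℝ) ^ d)⁻¹) ^ (1 / t) *
        (∑ y ∈ box 0 R, |v y| ^ t) ^ (1 / t) :=
        hterm.trans (le_mul_of_one_le_left (by positivity) hfactor)
    _ = (n : ℝ) ^ d * boxNorm t n v R := by
        rw [boxNorm, Real.mul_rpow (by positivity) (by positivity), mul_assoc]
    _ ≤ _ := by
        gcongr
        exact boxNorm_le_sobolevNorm v hn ht₀

end ScaledNorms

theorem boxNorm_le_mul_sobolevNorm {d : ℕ} (hd : 2 ≤ d) {r T : ℝ} (hr : 1 ≤ r) (hT : 0 < T)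
    (hrT : 1 / T = 1 / r - 1 / d) :
    ∃ C : ℝ, 0 ≤ C ∧ ∀ n R : ℕ, 1 ≤ n → n ≤ R → ∀ w : Vertex d → ℝ, (∀ x, 0 ≤ w x) →
      boxNorm T n w R ≤ C * sobolevNorm r n w R := by
  obtain ⟨C, hC, hsobolev⟩ := sobolev_box hd hr hT hrT
  refine ⟨C ^ (1 / T), by positivity, fun n R hn hnR w hw => ?_⟩
  have hn₀ : (0 : ℝ) < n := by exact_mod_cast hn
  have hE := sobolevNorm_nonneg (t := r) (n := n) (R := R) w
  have hexp : d * (T / r) - T = d := by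
    have hd₀ : (d : ℝ) ≠ 0 := by positivity
    have hr₀ : r ≠ 0 := by positivity
    field_simp at hrT ⊢
    linarith
  have hsum : ∑ x ∈ box 0 R, w x ^ T ≤ C * (sobolevNorm r n w R ^ T * (n : ℝ) ^ d) := by
    have hnR' : (n : ℝ) ≤ R := by exact_mod_cast hnR
    have h := hsobolev R n hn₀ (by linarith) w hw
    rwa [sobolevSum_rpow w hn, hexp, Real.rpow_natCast] at h
  have hsum₀ : 0 ≤ ∑ x ∈ box 0 R, w x ^ T :=
    Finset.sum_nonneg fun x _ => Real.rpow_nonneg (hw x) _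
  calc boxNorm T n w R
      ≤ (((n : ℝ) ^ d)⁻¹ * (C * (sobolevNorm r n w R ^ T * (n : ℝ) ^ d))) ^ (1 / T) := by
        simp only [boxNorm, abs_of_nonneg (hw _)]
        gcongr
    _ = (C * sobolevNorm r n w R ^ T) ^ (1 / T) := by
        congr 1
        field_simp
    _ = _ := by
        rw [Real.mul_rpow hC (by positivity), ← Real.rpow_mul hE, mul_one_div_cancel hT.ne',
          Real.rpow_one]

theorem boxNorm_rpow_le_sobolevNorm {d : ℕ} (hd : 2 ≤ d) {r β : ℝ} (hr : 1 ≤ r) (hrd : r < d)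
    (hβ : 0 < β) (hβd : β * (1 / r - 1 / d) ≤ 1 / r) :
    ∃ C : ℝ, 0 ≤ C ∧ ∀ n R : ℕ, 1 ≤ n → n ≤ R → R ≤ 4 * n → ∀ w : Vertex d → ℝ, (∀ x, 0 ≤ w x) →
      boxNorm r n (fun x => w x ^ β) R ≤ C * sobolevNorm r n w R ^ β := by
  have hr₀ : 0 < r := by linarith
  have hpos : 0 < 1 / r - 1 / (d : ℝ) := sub_pos.2 (one_div_lt_one_div_of_lt hr₀ hrd)
  set T := 1 / (1 / r - 1 / (d : ℝ)) with hT_def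
  have hT : 0 < T := one_div_pos.2 hpos
  have hβT : β * r ≤ T := by
    rw [hT_def, le_div_iff₀ hpos, mul_right_comm]
    exact (mul_le_mul_of_nonneg_right hβd hr₀.le).trans_eq (one_div_mul_cancel hr₀.ne')
  obtain ⟨C, hC, hsobolev⟩ := boxNorm_le_mul_sobolevNorm hd hr hT (one_div_one_div _)
  set D : ℝ := (9 ^ d) ^ ((1 - β * r / T) / (β * r))
  refine ⟨(D * C) ^ β, by positivity, fun n R hn hnR hR w hw => ?_⟩
  have hE := sobolevNorm_nonneg (t := r) (n := n) (R := R) w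
  calc boxNorm r n (fun x => w x ^ β) R = boxNorm (β * r) n w R ^ β := boxNorm_rpow_fun hw hβ
    _ ≤ (D * boxNorm T n w R) ^ β :=
        Real.rpow_le_rpow (boxNorm_nonneg w)
          (boxNorm_le_of_exponent_le w (by positivity) hβT hn hR) hβ.le
    _ ≤ (D * (C * sobolevNorm r n w R)) ^ β := by
        have := boxNorm_nonneg (t := T) (n := n) (R := R) w
        gcongr
        exact hsobolev n R hn hnR w hw
    _ = _ := by rw [← mul_assoc, Real.mul_rpow (by positivity) hE]

theorem sobolevNorm_rpow_le (d : ℕ) {r t δ : ℝ} (hδ : 0 ≤ δ) (hr : 1 ≤ r) (ht : 0 < t)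
    (htr : 1 / t = 1 / r + δ) :
    ∃ C : ℝ, 0 ≤ C ∧ ∀ n R : ℕ, 1 ≤ n → R ≤ 4 * n → ∀ w : Vertex d → ℝ, (∀ x, 0 ≤ w x) →
      sobolevNorm t n (fun x => w x ^ (1 + δ)) R ≤ C * sobolevNorm r n w R ^ (1 + δ) := by
  have hr₀ : 0 < r := by linarith
  have hθ : 1 - t / r = δ * t := by
    field_simp at htr ⊢
    linarith
  have htr' : t ≤ r := (div_le_one hr₀).1 (sub_nonneg.1 (hθ ▸ by positivity))
  set C₁ : ℝ := (1 + δ) ^ t * (2 * d) ^ (1 - t / r) + 1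
  set D : ℝ := ((9 : ℝ) ^ d) ^ ((1 - 1 / r) / 1)
  refine ⟨C₁ ^ (1 / t) * D ^ δ, by positivity, fun n R hn hR w hw => ?_⟩
  have hn₀ : (0 : ℝ) < n := by exact_mod_cast hn
  set M := ∑ x ∈ box 0 R, w x ^ (1 : ℝ)
  have hM : 0 ≤ M := Finset.sum_nonneg fun x _ => Real.rpow_nonneg (hw x) _
  set H := sobolevSum r n w (box 0 R)
  have hH : 0 ≤ H := sobolevSum_nonneg hn₀.le r w _
  have hE := sobolevNorm_nonneg (t := r) (n := n) (R := R) w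
  set N : ℝ := ((n : ℝ) ^ d)⁻¹
  have hN : 0 < N := by positivity
  have hsum : sobolevSum t n (fun x => w x ^ (1 + δ)) (box 0 R) ≤
      C₁ * (M ^ (1 - t / r) * H ^ (t / r)) :=
    sobolevSum_rpow_le _ hn₀ ht htr' (by linarith) zero_le_one (by rw [hθ]; ring) hw
  have hmean : N * M ≤ D * sobolevNorm r n w R := by
    have h := (boxNorm_le_of_exponent_le w one_pos hr hn hR).trans
      (mul_le_mul_of_nonneg_left (boxNorm_le_sobolevNorm w hn hr₀) (by positivity))
    simpa only [M, D, boxNorm, abs_of_nonneg (hw _), div_one, Real.rpow_one] using h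
  have hsum₀ := sobolevSum_nonneg hn₀.le t (fun x => w x ^ (1 + δ)) (box 0 R)
  have hscale : N * (M ^ (1 - t / r) * H ^ (t / r)) = (N * M) ^ (δ * t) * (N * H) ^ (t / r) := by
    have hNN : N ^ (δ * t) * N ^ (t / r) = N := by
      rw [← Real.rpow_add hN, ← hθ, sub_add_cancel, Real.rpow_one]
    rw [Real.mul_rpow hN.le hM, Real.mul_rpow hN.le hH, hθ]
    linear_combination -(M ^ (δ * t) * H ^ (t / r)) * hNN
  calc sobolevNorm t n (fun x => w x ^ (1 + δ)) R
      ≤ n * (N * (C₁ * (M ^ (1 - t / r) * H ^ (t / r)))) ^ (1 / t) := by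
        unfold sobolevNorm
        gcongr
    _ = C₁ ^ (1 / t) * ((N * M) ^ δ * sobolevNorm r n w R) := by
        rw [mul_left_comm N, hscale, Real.mul_rpow (by positivity) (by positivity),
          Real.mul_rpow (by positivity) (by positivity), ← Real.rpow_mul (by positivity),
          ← Real.rpow_mul (by positivity), mul_one_div, mul_one_div, mul_div_cancel_right₀ δ ht.ne',
          div_div_cancel_left' ht.ne', sobolevNorm, one_div r]
        ring
    _ ≤ C₁ ^ (1 / t) * ((D * sobolevNorm r n w R) ^ δ * sobolevNorm r n w R) := by gcongr
    _ = _ := by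
        rw [Real.mul_rpow (by positivity) hE, add_comm 1 δ, Real.rpow_add_one' hE (by linarith)]
        ring

/-! ### Gradient norms and weighted energy -/

/-- The exponent `2 * q / (q + 1)`, equal to `2` for `q = ∞`: the gradient norm with this exponent
is controlled by the energy `∑ e, ω e * grad v e ^ 2` and the `L^q` norm of `ω⁻¹`. -/
noncomputable def gradExponent (q : ℝ≥0∞) : ℝ := 2 / (1 + (q⁻¹).toReal)

section GradExponent

variable {q : ℝ≥0∞}

theorem one_div_gradExponent (q : ℝ≥0∞) : 1 / gradExponent q = (1 + (q⁻¹).toReal) / 2 :=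
  one_div_div _ _

theorem two_div_gradExponent (q : ℝ≥0∞) : 2 / gradExponent q = 1 + (q⁻¹).toReal :=
  div_div_cancel₀ two_ne_zero

theorem gradExponent_pos (q : ℝ≥0∞) : 0 < gradExponent q := by
  have : 0 ≤ (q⁻¹).toReal := ENNReal.toReal_nonneg
  unfold gradExponent
  positivity

theorem gradExponent_le_two (q : ℝ≥0∞) : gradExponent q ≤ 2 :=
  div_le_self zero_le_two (le_add_of_nonneg_right ENNReal.toReal_nonneg)

theorem one_le_gradExponent (hq : 1 ≤ q) : 1 ≤ gradExponent q := by
  have : 0 ≤ (q⁻¹).toReal := ENNReal.toReal_nonneg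
  rw [gradExponent, le_div_iff₀ (by positivity)]
  linarith [inv_toReal_le_one hq]

theorem sum_abs_rpow_gradExponent_le {ι : Type*} (hq : 1 ≤ q) {S T : Finset ι} (hTS : T ⊆ S)
    {ω : ι → ℝ} (hω : ∀ e, 0 < ω e) (f : ι → ℝ) :
    (∑ e ∈ T, |f e| ^ gradExponent q) ^ (2 / gradExponent q) ≤
      (S.card : ℝ) ^ (q⁻¹).toReal * avgNorm q S (fun e => (ω e)⁻¹) * ∑ e ∈ T, ω e * f e ^ 2 := by
  set r := gradExponent q
  set b := (q⁻¹).toReal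
  have hr : 0 < r := gradExponent_pos q
  have hb : b ≤ 1 := inv_toReal_le_one hq
  have hrb : 2 / r = 1 + b := two_div_gradExponent q
  have hω' : ∀ e, 0 ≤ (ω e)⁻¹ := fun e => (inv_pos.2 (hω e)).le
  set X := ∑ e ∈ T, |f e| ^ r
  have hX : 0 ≤ X := by positivity
  have hE : 0 ≤ ∑ e ∈ T, ω e * f e ^ 2 :=
    Finset.sum_nonneg fun e _ => mul_nonneg (hω e).le (sq_nonneg _)
  have hA := avgNorm_nonneg q S fun e => (ω e)⁻¹
  have hsplit : ∀ e, (|f e| ^ r) ^ 2 = ω e * f e ^ 2 * ((ω e)⁻¹ * (|f e| ^ r) ^ (1 - b)) := by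
    intro e
    have hexp : r * 2 = 2 + r * (1 - b) := by
      rw [div_eq_iff hr.ne'] at hrb
      linarith
    rw [mul_mul_mul_comm, mul_inv_cancel₀ (hω e).ne', one_mul, ← sq_abs (f e), ← Real.rpow_two,
      ← Real.rpow_two, ← Real.rpow_mul (abs_nonneg _), ← Real.rpow_mul (abs_nonneg _), hexp]
    exact Real.rpow_add_of_nonneg (abs_nonneg _) zero_le_two (mul_nonneg hr.le (sub_nonneg.2 hb))
  have hsq : X ^ 2 ≤ (∑ e ∈ T, ω e * f e ^ 2) *
      ((S.card : ℝ) ^ b * avgNorm q S (fun e => (ω e)⁻¹) * X ^ (1 - b)) :=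
    (Finset.sum_sq_le_sum_mul_sum_of_sq_le_mul T
      (fun e _ => mul_nonneg (hω e).le (sq_nonneg _))
      (fun e _ => mul_nonneg (hω' e) (by positivity)) fun e _ => (hsplit e).le).trans <|
    mul_le_mul_of_nonneg_left
      (sum_mul_rpow_le_avgNorm hq hTS hω' fun e => Real.rpow_nonneg (abs_nonneg _) _) hE
  rcases hX.eq_or_lt with hX₀ | hX₀
  · rw [← hX₀, Real.zero_rpow (by positivity)]
    positivity
  have hXX : X ^ 2 = X ^ (2 / r) * X ^ (1 - b) := by
    rw [← Real.rpow_add hX₀, hrb, ← Real.rpow_two]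
    ring_nf
  refine le_of_mul_le_mul_right (hXX.symm.trans_le (hsq.trans_eq ?_))
    (Real.rpow_pos_of_pos hX₀ (1 - b))
  ring

theorem gradNorm_sq_le {d : ℕ} (hq : 1 ≤ q) {ω : Bond d → ℝ} (hω : ∀ e, 0 < ω e) {n R : ℕ}
    (hn : 1 ≤ n) (hR : R ≤ 4 * n) (v : Vertex d → ℝ) :
    gradNorm (gradExponent q) n v R ^ 2 ≤ (d * 9 ^ d) ^ (q⁻¹).toReal *
      avgNorm q (bondsIn (box 0 (4 * n))) (fun e => (ω e)⁻¹) *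
        ((n : ℝ) ^ 2 * (((n : ℝ) ^ d)⁻¹ * ∑ e ∈ bondsIn (box 0 R), ω e * grad v e ^ 2)) := by
  have hinterp := sum_abs_rpow_gradExponent_le hq (bondsIn_mono (box_zero_mono hR)) hω (grad v)
  set b := (q⁻¹).toReal
  have hb : 0 ≤ b := ENNReal.toReal_nonneg
  set S := bondsIn (box (0 : Vertex d) (4 * n))
  set A := avgNorm q S fun e => (ω e)⁻¹
  have hA : 0 ≤ A := avgNorm_nonneg _ _ _
  set X := ∑ e ∈ bondsIn (box 0 R), |grad v e| ^ gradExponent q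
  have hE : 0 ≤ ∑ e ∈ bondsIn (box 0 R), ω e * grad v e ^ 2 :=
    Finset.sum_nonneg fun e _ => mul_nonneg (hω e).le (sq_nonneg _)
  set E := ∑ e ∈ bondsIn (box 0 R), ω e * grad v e ^ 2
  have hN : (0 : ℝ) < (n : ℝ) ^ d := by
    have : 0 < n := hn
    positivity
  set N := (n : ℝ) ^ d
  have hcard : (S.card : ℝ) ≤ d * 9 ^ d * N := card_bondsIn_box_le d hn
  have hscale : N⁻¹ ^ (1 + b) * N ^ b = N⁻¹ := by
    rw [Real.inv_rpow hN.le, ← Real.rpow_neg hN.le, ← Real.rpow_add hN, ← Real.rpow_neg_one]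
    ring_nf
  calc gradNorm (gradExponent q) n v R ^ 2
      = (n : ℝ) ^ 2 * (N⁻¹ ^ (1 + b) * X ^ (2 / gradExponent q)) := by
        rw [gradNorm, mul_pow, ← Real.rpow_two ((_ : ℝ) ^ (1 / gradExponent q)),
          ← Real.rpow_mul (by positivity), one_div_mul_eq_div,
          Real.mul_rpow (by positivity) (by positivity), two_div_gradExponent]
    _ ≤ (n : ℝ) ^ 2 * (N⁻¹ ^ (1 + b) * ((d * 9 ^ d * N) ^ b * A * E)) := by
        gcongr
        exact hinterp.trans (by gcongr)
    _ = (d * 9 ^ d) ^ b * A * ((n : ℝ) ^ 2 * (N⁻¹ * E)) := by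
        rw [Real.mul_rpow (by positivity) hN.le]
        linear_combination (d * 9 ^ d) ^ b * A * (n : ℝ) ^ 2 * E * hscale

end GradExponent

theorem bondsIn_box_nonempty {d R : ℕ} (hd : 1 ≤ d) (hR : 1 ≤ R) :
    (bondsIn (box (0 : Vertex d) R)).Nonempty := by
  refine ⟨(0, ⟨0, hd⟩), mem_bondsIn.2 ⟨mem_box_zero.2 fun i => ?_, mem_box_zero.2 fun i => ?_⟩⟩
  · simp [lower]
  · simp only [upper, Pi.add_apply, Pi.single_apply, Pi.zero_apply]
    split_ifs <;> omega

theorem one_le_ellipticity {d : ℕ} {p q : ℝ≥0∞} (hp : 1 ≤ p) (hq : 1 ≤ q) {ω : Bond d → ℝ}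
    (hω : ∀ e, 0 < ω e) {S : Finset (Vertex d)} (hS : (bondsIn S).Nonempty) :
    1 ≤ ellipticity p q ω S := by
  have hcard : (0 : ℝ) < (bondsIn S).card := by exact_mod_cast hS.card_pos
  have hmean : ∑ e ∈ bondsIn S, ω e ≤ (bondsIn S).card * avgNorm p (bondsIn S) ω := by
    have h := sum_mul_rpow_le_avgNorm hp (Finset.Subset.refl (bondsIn S)) (g := fun _ => 1)
      (fun e => (hω e).le) fun _ => zero_le_one
    simp only [Real.one_rpow, mul_one, Finset.sum_const, nsmul_eq_mul] at h
    rwa [mul_right_comm, ← Real.rpow_add hcard, add_sub_cancel, Real.rpow_one] at h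
  have hinv := sum_abs_rpow_gradExponent_le hq (Finset.Subset.refl (bondsIn S)) hω fun _ => 1
  simp only [abs_one, Real.one_rpow, Finset.sum_const, nsmul_eq_mul, mul_one, one_pow,
    two_div_gradExponent, Real.rpow_one_add' hcard.le (add_pos_of_pos_of_nonneg one_pos
      ENNReal.toReal_nonneg).ne'] at hinv
  have hA := avgNorm_nonneg q (bondsIn S) fun e => (ω e)⁻¹
  refine le_of_mul_le_mul_left ?_
    (mul_pos hcard (Real.rpow_pos_of_pos hcard (q⁻¹).toReal))
  calc _ ≤ _ := (mul_one _).trans_le hinv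
    _ ≤ _ := mul_le_mul_of_nonneg_left hmean (by positivity)
    _ = _ := by rw [ellipticity]; ring

theorem scaled_energy_eq {m n σ : ℕ} (hm : 0 < m) (hn : 1 ≤ n) {N a t : ℝ} (hN : 0 < N)
    (htp : 1 / t = (1 - a) / 2 + 1 / m) (v : Vertex (m + 1) → ℝ) :
    (n : ℝ) ^ 2 * (((n : ℝ) ^ (m + 1))⁻¹ * (((n : ℝ) ^ (m + 1) / N) ^ a * (1 / N) *
      (sobolevSum t n v (box 0 σ) / N) ^ (2 / t))) =
      (n / N) ^ (2 + 2 / (m : ℝ)) * sobolevNorm t n v σ ^ 2 := by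
  have hn₀ : (0 : ℝ) < n := by exact_mod_cast hn
  have hm₀ : (m : ℝ) ≠ 0 := by positivity
  have ht : 2 / t = 1 - a + 2 / m := by
    linear_combination 2 * htp
  have hexp : 2 + 2 / (m : ℝ) = a + 1 + 2 / t := by
    rw [ht]
    ring
  have hpow : (n : ℝ) ^ 2 * (((n : ℝ) ^ (m + 1))⁻¹ * (((n : ℝ) ^ (m + 1)) ^ a *
      (n : ℝ) ^ (((m + 1 : ℕ) : ℝ) * (2 / t) - 2))) = (n : ℝ) ^ (a + 1 + 2 / t) := by
    rw [← Real.rpow_natCast _ 2, ← Real.rpow_natCast _ (m + 1), ← Real.rpow_mul hn₀.le,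
      ← Real.rpow_neg hn₀.le, ← Real.rpow_add hn₀, ← Real.rpow_add hn₀, ← Real.rpow_add hn₀, ht]
    congr 1
    push_cast
    field_simp
    ring
  rw [Real.div_rpow (sobolevSum_nonneg hn₀.le _ _ _) hN.le, sobolevSum_rpow v hn, Real.rpow_two,
    Real.div_rpow (by positivity) hN.le, Real.div_rpow hn₀.le hN.le, hexp, ← hpow,
    Real.rpow_add hN, Real.rpow_add hN, Real.rpow_one]
  field_simp

theorem gradNorm_sq_le_sobolevNorm {m : ℕ} (hm : 2 ≤ m) {p q : ℝ≥0∞} (hp : 1 < p) (hq : 1 ≤ q)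
    {t : ℝ} (ht : 1 ≤ t) (htp : 1 / t = (1 - (p⁻¹).toReal) / 2 + 1 / m) :
    ∃ C : ℝ, 0 ≤ C ∧ ∀ ω : Bond (m + 1) → ℝ, (∀ e, 0 < ω e) → ∀ (u : Vertex (m + 1) → ℝ) (α : ℝ),
      1 ≤ α → ∀ n ρ σ : ℕ, 1 ≤ n → n ≤ ρ → ρ < σ → σ ≤ 4 * n → IsHarmonicWithin ω σ u →
        gradNorm (gradExponent q) n (fun x => |u x| ^ α) ρ ^ 2 ≤
          C * α * ellipticity p q ω (box 0 (4 * n)) * ((n : ℝ) / (σ - ρ)) ^ (2 + 2 / (m : ℝ)) *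
            sobolevNorm t n (fun x => |u x| ^ α) σ ^ 2 := by
  obtain ⟨C, hC, henergy⟩ := energy_le_sobolevSum hm hp ht htp
  set D : ℝ := ((m + 1 : ℕ) * 9 ^ (m + 1)) ^ (q⁻¹).toReal
  refine ⟨D * C, by positivity, fun ω hω u α hα n ρ σ hn hnρ hρσ hσ hu => ?_⟩
  have hN : (0 : ℝ) < σ - ρ := sub_pos.2 (by exact_mod_cast hρσ)
  have hA := avgNorm_nonneg q (bondsIn (box (0 : Vertex (m + 1)) (4 * n))) fun e => (ω e)⁻¹
  have hgrad := gradNorm_sq_le hq hω hn (hρσ.le.trans hσ) fun x => |u x| ^ α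
  refine hgrad.trans <| (mul_le_mul_of_nonneg_left (mul_le_mul_of_nonneg_left
    (mul_le_mul_of_nonneg_left (henergy ω hω u α hα n ρ σ hn hnρ hρσ hσ hu) (by positivity))
    (by positivity)) (by positivity)).trans_eq ?_
  rw [mul_assoc (D * C * α * _), ← scaled_energy_eq (by omega) hn hN htp, ellipticity]
  ring

/-! ### One step of the iteration -/

theorem gap_succ (m : ℕ) (p q : ℝ≥0∞) :
    gap (m + 1) p q = 1 / m - (p⁻¹).toReal / 2 - (q⁻¹).toReal / 2 := by
  rw [gap, Nat.cast_succ, add_sub_cancel_right]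

section MoserStep

variable {m : ℕ} {p q : ℝ≥0∞}

theorem one_div_gradExponent_add_gap (m : ℕ) (p q : ℝ≥0∞) :
    1 / gradExponent q + gap (m + 1) p q = (1 - (p⁻¹).toReal) / 2 + 1 / m := by
  rw [one_div_gradExponent, gap_succ]
  ring

theorem gap_le_one_div (m : ℕ) (p q : ℝ≥0∞) : gap (m + 1) p q ≤ 1 / m := by
  have ha : 0 ≤ (p⁻¹).toReal := ENNReal.toReal_nonneg
  have hb : 0 ≤ (q⁻¹).toReal := ENNReal.toReal_nonneg
  rw [gap_succ]
  linarith

theorem one_add_gap_mul_le (hm : 1 ≤ m) (hq : 1 ≤ q) :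
    (1 + gap (m + 1) p q) * (1 / gradExponent q - 1 / (m + 1 : ℕ)) ≤ 1 / gradExponent q := by
  have hm₀ : (1 : ℝ) ≤ m := by exact_mod_cast hm
  have hr : 1 / gradExponent q ≤ 1 :=
    (div_le_one (gradExponent_pos q)).2 (one_le_gradExponent hq)
  have hr' : 1 / 2 ≤ 1 / gradExponent q :=
    one_div_le_one_div_of_le (gradExponent_pos q) (gradExponent_le_two q)
  have hdim : 1 / ((m + 1 : ℕ) : ℝ) ≤ 1 / 2 :=
    one_div_le_one_div_of_le two_pos (by push_cast; linarith)
  have hbound : gap (m + 1) p q * (1 / gradExponent q - 1 / (m + 1 : ℕ)) ≤ 1 / (m + 1 : ℕ) := calc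
    _ ≤ 1 / (m : ℝ) * (1 - 1 / (m + 1 : ℕ)) :=
      mul_le_mul (gap_le_one_div m p q) (by linarith) (by linarith) (by positivity)
    _ = _ := by
      push_cast
      field_simp
      ring
  linarith

theorem exists_one_div_eq_add_gap (hm : 2 ≤ m) (hgap : 0 < gap (m + 1) p q) :
    ∃ t : ℝ, 1 ≤ t ∧ 1 / t = 1 / gradExponent q + gap (m + 1) p q := by
  have hr := gradExponent_pos q
  refine ⟨1 / (1 / gradExponent q + gap (m + 1) p q), ?_, one_div_one_div _⟩
  rw [one_le_div (by positivity), one_div_gradExponent_add_gap]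
  have ha : 0 ≤ (p⁻¹).toReal := ENNReal.toReal_nonneg
  have hm₂ : 1 / (m : ℝ) ≤ 1 / 2 := one_div_le_one_div_of_le two_pos (by exact_mod_cast hm)
  linarith

theorem gradNorm_rpow_le (hm : 2 ≤ m) (hp : 1 < p) (hq : 1 ≤ q) (hgap : 0 < gap (m + 1) p q) :
    ∃ C : ℝ, 0 ≤ C ∧ ∀ ω : Bond (m + 1) → ℝ, (∀ e, 0 < ω e) → ∀ (u : Vertex (m + 1) → ℝ) (α : ℝ),
      1 ≤ α → ∀ n ρ σ : ℕ, 1 ≤ n → n ≤ ρ → ρ < σ → σ ≤ ρ + n → σ ≤ 4 * n →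
        IsHarmonicWithin ω σ u →
          gradNorm (gradExponent q) n (fun x => |u x| ^ (α * (1 + gap (m + 1) p q))) ρ ≤
            C * (√α * √(ellipticity p q ω (box 0 (4 * n))) * ((n : ℝ) / (σ - ρ)) ^ 2) *
              sobolevNorm (gradExponent q) n (fun x => |u x| ^ α) σ ^
                (1 + gap (m + 1) p q) := by
  set δ := gap (m + 1) p q
  set r := gradExponent q
  have hr : 1 ≤ r := one_le_gradExponent hq
  have : 0 < r := gradExponent_pos q
  obtain ⟨t, ht, htr⟩ := exists_one_div_eq_add_gap hm hgap
  have htp := htr.trans (one_div_gradExponent_add_gap m p q)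
  have hm₂ : 1 / (m : ℝ) ≤ 1 / 2 := one_div_le_one_div_of_le two_pos (by exact_mod_cast hm)
  obtain ⟨C, hC, hgrad⟩ := gradNorm_sq_le_sobolevNorm hm hp hq ht htp
  obtain ⟨D, hD, hpower⟩ :=
    sobolevNorm_rpow_le (m + 1) hgap.le hr (zero_lt_one.trans_le ht) htr
  refine ⟨√(C * (1 + δ)) * D, by positivity, fun ω hω u α hα n ρ σ hn hnρ hρσ hσρ hσ hu => ?_⟩
  have hN : (0 : ℝ) < σ - ρ := sub_pos.2 (by exact_mod_cast hρσ)
  set κ : ℝ := n / (σ - ρ)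
  have hκ : 1 ≤ κ := by
    rw [one_le_div hN, sub_le_iff_le_add']
    exact_mod_cast hσρ
  have hΛ : 0 ≤ ellipticity p q ω (box 0 (4 * n)) :=
    mul_nonneg (avgNorm_nonneg _ _ _) (avgNorm_nonneg _ _ _)
  set Λ := ellipticity p q ω (box 0 (4 * n))
  set w : Vertex (m + 1) → ℝ := fun x => |u x| ^ α
  have hE := sobolevNorm_nonneg (t := r) (n := n) (R := σ) w
  have hEt := sobolevNorm_nonneg (t := t) (n := n) (R := σ) fun x => w x ^ (1 + δ)
  have hα' : 1 ≤ α * (1 + δ) := by nlinarith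
  have hsq := hgrad ω hω u (α * (1 + δ)) hα' n ρ σ hn hnρ hρσ hσ hu
  have hw : (fun x => |u x| ^ (α * (1 + δ))) = fun x => w x ^ (1 + δ) :=
    funext fun x => Real.rpow_mul (abs_nonneg _) _ _
  rw [hw] at hsq ⊢
  have hκ' : κ ^ (2 + 2 / (m : ℝ)) ≤ (κ ^ 2) ^ 2 := by
    rw [← pow_mul, ← Real.rpow_natCast]
    refine Real.rpow_le_rpow_of_exponent_le hκ ?_
    push_cast
    linarith [mul_one_div (2 : ℝ) m]
  refine (pow_le_pow_iff_left₀ (gradNorm_nonneg _) (by positivity) two_ne_zero).1 (hsq.trans ?_)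
  calc _ ≤ C * (α * (1 + δ)) * Λ * (κ ^ 2) ^ 2 *
        (D * sobolevNorm r n w σ ^ (1 + δ)) ^ 2 := by
        gcongr
        exact hpower n σ hn hσ w fun x => Real.rpow_nonneg (abs_nonneg _) _
    _ = _ := by
        simp only [mul_pow, Real.sq_sqrt hΛ, Real.sq_sqrt (zero_le_one.trans hα),
          Real.sq_sqrt (show 0 ≤ C * (1 + δ) by positivity)]
        ring

theorem sobolevNorm_step (hm : 2 ≤ m) (hp : 1 < p) (hq : 1 ≤ q) (hgap : 0 < gap (m + 1) p q) :
    ∃ C : ℝ, 0 ≤ C ∧ ∀ ω : Bond (m + 1) → ℝ, (∀ e, 0 < ω e) → ∀ (u : Vertex (m + 1) → ℝ) (α : ℝ),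
      1 ≤ α → ∀ n ρ σ : ℕ, 1 ≤ n → n ≤ ρ → ρ < σ → σ ≤ ρ + n → σ ≤ 4 * n →
        IsHarmonicWithin ω σ u →
          sobolevNorm (gradExponent q) n (fun x => |u x| ^ (α * (1 + gap (m + 1) p q))) ρ ≤
            C * (√α * √(ellipticity p q ω (box 0 (4 * n))) * ((n : ℝ) / (σ - ρ)) ^ 2) *
              sobolevNorm (gradExponent q) n (fun x => |u x| ^ α) σ ^
                (1 + gap (m + 1) p q) := by
  obtain ⟨C, hC, hgrad⟩ := gradNorm_rpow_le hm hp hq hgap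
  have hexp := one_add_gap_mul_le (m := m) (p := p) (by omega) hq
  set δ := gap (m + 1) p q
  set r := gradExponent q
  have hr : 1 ≤ r := one_le_gradExponent hq
  have hrm : r < (m + 1 : ℕ) :=
    (gradExponent_le_two q).trans_lt (by exact_mod_cast (by omega : 2 < m + 1))
  obtain ⟨D, hD, hbox⟩ := boxNorm_rpow_le_sobolevNorm (by omega) hr hrm (by positivity) hexp
  refine ⟨C + D, by positivity, fun ω hω u α hα n ρ σ hn hnρ hρσ hσρ hσ hu => ?_⟩
  have hN : (0 : ℝ) < σ - ρ := sub_pos.2 (by exact_mod_cast hρσ)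
  have hκ : 1 ≤ (n : ℝ) / (σ - ρ) := by
    rw [one_le_div hN, sub_le_iff_le_add']
    exact_mod_cast hσρ
  have hΛ : 1 ≤ ellipticity p q ω (box 0 (4 * n)) :=
    one_le_ellipticity hp.le hq hω (bondsIn_box_nonempty (by omega) (by omega))
  set w : Vertex (m + 1) → ℝ := fun x => |u x| ^ α
  set F := √α * √(ellipticity p q ω (box 0 (4 * n))) * ((n : ℝ) / (σ - ρ)) ^ 2
  have hF : 1 ≤ F := one_le_mul_of_one_le_of_one_le (one_le_mul_of_one_le_of_one_le
    (Real.one_le_sqrt.2 hα) (Real.one_le_sqrt.2 hΛ)) (one_le_pow₀ hκ)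
  have hEρ := sobolevNorm_nonneg (t := r) (n := n) (R := ρ) w
  have hmono := sobolevNorm_mono (n := n) w (zero_lt_one.trans_le hr) hρσ.le
  have hboxNorm : boxNorm r n (fun x => |u x| ^ (α * (1 + δ))) ρ ≤
      D * F * sobolevNorm r n w σ ^ (1 + δ) := by
    simp only [Real.rpow_mul (abs_nonneg _)]
    calc _ ≤ D * sobolevNorm r n w ρ ^ (1 + δ) :=
          hbox n ρ hn hnρ (hρσ.le.trans hσ) w fun x => Real.rpow_nonneg (abs_nonneg _) _
      _ ≤ D * sobolevNorm r n w σ ^ (1 + δ) :=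
          mul_le_mul_of_nonneg_left (Real.rpow_le_rpow hEρ hmono (by positivity)) hD
      _ ≤ _ :=
          mul_le_mul_of_nonneg_right (le_mul_of_one_le_right hD hF)
            (Real.rpow_nonneg (hEρ.trans hmono) _)
  refine (sobolevNorm_le_add _ hn hr).trans ?_
  linarith [hgrad ω hω u α hα n ρ σ hn hnρ hρσ hσρ hσ hu]

end MoserStep

/-! ### Start of the iteration -/

theorem toReal_two_mul_conjExponent {p : ℝ≥0∞} (hp : 1 < p) :
    (2 * p.conjExponent).toReal = 2 / (1 - (p⁻¹).toReal) := by
  have hinv := (ENNReal.HolderConjugate.conjExponent hp.le).inv_add_inv_eq_one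
  have hconj : p.conjExponent⁻¹ = 1 - p⁻¹ :=
    ENNReal.eq_sub_of_add_eq' ENNReal.one_ne_top (by rw [add_comm, hinv])
  rw [ENNReal.toReal_mul, ENNReal.toReal_ofNat, ← inv_inv p.conjExponent, ENNReal.toReal_inv,
    hconj, ENNReal.toReal_sub_of_le (ENNReal.inv_le_one.2 hp.le) ENNReal.one_ne_top,
    ENNReal.toReal_one, div_eq_mul_inv]

theorem two_le_toReal_two_mul_conjExponent {p : ℝ≥0∞} (hp : 1 < p) :
    2 ≤ (2 * p.conjExponent).toReal := by
  have ha : 0 ≤ (p⁻¹).toReal := ENNReal.toReal_nonneg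
  rw [toReal_two_mul_conjExponent hp, le_div_iff₀ (sub_pos.2 (inv_toReal_lt_one hp))]
  linarith

theorem sum_bondMax_rpow_le {d n : ℕ} {P : ℝ≥0∞} (hP₀ : P ≠ 0) (hP : P ≠ ∞) (hn : 1 ≤ n)
    (u : Vertex d → ℝ) :
    ∑ e ∈ bondsIn (box 0 (4 * n)), bondMax (fun x => |u x|) e ^ P.toReal ≤
      2 * (d * 9 ^ d * (n : ℝ) ^ d) * avgNorm P (box 0 (4 * n)) u ^ P.toReal := by
  have hbox := card_box_le d hn
  have hU := Real.rpow_nonneg (avgNorm_nonneg P (box 0 (4 * n)) u) P.toReal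
  calc _ ≤ 2 * d * ∑ x ∈ box 0 (4 * n), |u x| ^ P.toReal := by
        simp only [← bondMax_rpow (fun x => abs_nonneg (u x)) ENNReal.toReal_nonneg]
        exact sum_bondMax_le _ fun x => by positivity
    _ ≤ 2 * d * (9 ^ d * (n : ℝ) ^ d * avgNorm P (box 0 (4 * n)) u ^ P.toReal) := by
        rw [← card_mul_avgNorm_rpow hP₀ hP]
        gcongr
    _ = _ := by ring

theorem sum_mul_bondMax_sq_le {d n : ℕ} {p : ℝ≥0∞} (hp : 1 < p) (hn : 1 ≤ n) {ω : Bond d → ℝ}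
    (hω : ∀ e, 0 ≤ ω e) (u : Vertex d → ℝ) :
    ∑ e ∈ bondsIn (box 0 (4 * n)), ω e * bondMax (fun x => |u x|) e ^ 2 ≤
      2 * (d * 9 ^ d * (n : ℝ) ^ d) * avgNorm p (bondsIn (box 0 (4 * n))) ω *
        avgNorm (2 * p.conjExponent) (box 0 (4 * n)) u ^ 2 := by
  set S := bondsIn (box (0 : Vertex d) (4 * n))
  set U := avgNorm (2 * p.conjExponent) (box 0 (4 * n)) u
  have hU : 0 ≤ U := avgNorm_nonneg _ _ _
  have hω_avg := avgNorm_nonneg p S ω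
  have hT := two_le_toReal_two_mul_conjExponent hp
  have hT₀ := ENNReal.toReal_pos_iff.1 (zero_lt_two.trans_le hT)
  have ha₁ : 0 < 1 - (p⁻¹).toReal := sub_pos.2 (inv_toReal_lt_one hp)
  have hTa : (2 * p.conjExponent).toReal * (1 - (p⁻¹).toReal) = 2 := by
    rw [toReal_two_mul_conjExponent hp, div_mul_cancel₀ _ ha₁.ne']
  have hpow := sum_bondMax_rpow_le hT₀.1.ne' hT₀.2.ne hn u
  set T := (2 * p.conjExponent).toReal
  set a := (p⁻¹).toReal
  have ha : 0 ≤ a := ENNReal.toReal_nonneg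
  set K : ℝ := 2 * (d * 9 ^ d * (n : ℝ) ^ d)
  have hK : 0 ≤ K := by positivity
  have hS : (S.card : ℝ) ≤ K :=
    (card_bondsIn_box_le d hn).trans (le_mul_of_one_le_left (by positivity) one_le_two)
  have hmax : ∀ e, 0 ≤ bondMax (fun x => |u x|) e := bondMax_nonneg fun x => abs_nonneg _
  calc _ = ∑ e ∈ S, ω e * (bondMax (fun x => |u x|) e ^ T) ^ (1 - a) := by
        simp only [← Real.rpow_mul (hmax _), hTa, Real.rpow_two]
    _ ≤ (S.card : ℝ) ^ a * avgNorm p S ω *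
          (∑ e ∈ S, bondMax (fun x => |u x|) e ^ T) ^ (1 - a) :=
        sum_mul_rpow_le_avgNorm hp.le (Finset.Subset.refl S) hω
          fun e => Real.rpow_nonneg (hmax e) T
    _ ≤ K ^ a * avgNorm p S ω * (K * U ^ T) ^ (1 - a) := by
        have := Finset.sum_nonneg fun e (_ : e ∈ S) => Real.rpow_nonneg (hmax e) T
        gcongr
    _ = K ^ (a + (1 - a)) * avgNorm p S ω * U ^ (T * (1 - a)) := by
        rw [Real.mul_rpow hK (by positivity), ← Real.rpow_mul hU,
          Real.rpow_add_of_nonneg hK ha ha₁.le]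
        ring
    _ = _ := by rw [add_sub_cancel, Real.rpow_one, hTa, Real.rpow_two]

theorem energy_le_avgNorm {d n : ℕ} {p : ℝ≥0∞} (hp : 1 < p) (hn : 1 ≤ n) {ω : Bond d → ℝ}
    (hω : ∀ e, 0 < ω e) {u : Vertex d → ℝ} (hu : IsHarmonicWithin ω (4 * n) u) :
    (n : ℝ) ^ 2 * (((n : ℝ) ^ d)⁻¹ *
        ∑ e ∈ bondsIn (box 0 (2 * n)), ω e * grad (fun x => |u x|) e ^ 2) ≤
      3 * (d * 9 ^ d) * avgNorm p (bondsIn (box 0 (4 * n))) ω *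
        avgNorm (2 * p.conjExponent) (box 0 (4 * n)) u ^ 2 := by
  have : (0 : ℝ) < n := by exact_mod_cast hn
  set G := Finset.Ico (2 * n) (4 * n)
  have hG : (G.card : ℝ) = 2 * n := by
    rw [Nat.card_Ico, show 4 * n - 2 * n = 2 * n by omega]
    push_cast
    rfl
  have hcacc := caccioppoli_layers hω hu le_rfl (by omega) (Finset.Subset.refl G)
    (Finset.nonempty_Ico.2 (by omega))
  simp only [Real.rpow_one, hG] at hcacc
  have hlayers : ∑ k ∈ G, ∑ e ∈ layer d k, ω e * bondMax (fun x => |u x|) e ^ 2 ≤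
      ∑ e ∈ bondsIn (box 0 (4 * n)), ω e * bondMax (fun x => |u x|) e ^ 2 := by
    rw [← Finset.sum_biUnion fun k _ l _ hkl => pairwise_disjoint_layer d hkl]
    exact Finset.sum_le_sum_of_subset_of_nonneg
      (Finset.biUnion_subset.2 fun k hk => layer_subset (Finset.mem_Ico.1 hk).2)
      fun e _ _ => mul_nonneg (hω e).le (sq_nonneg _)
  have hmass := hlayers.trans (sum_mul_bondMax_sq_le hp hn (fun e => (hω e).le) u)
  refine (mul_le_mul_of_nonneg_left (mul_le_mul_of_nonneg_left (hcacc.trans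
    (mul_le_mul_of_nonneg_left (mul_le_mul_of_nonneg_left hmass (by positivity)) (by positivity)))
    (by positivity)) (by positivity)).trans_eq ?_
  field_simp
  ring

theorem sobolevNorm_start {d : ℕ} (hd : 1 ≤ d) {p q : ℝ≥0∞} (hp : 1 < p) (hq : 1 ≤ q) :
    ∃ C : ℝ, 0 ≤ C ∧ ∀ ω : Bond d → ℝ, (∀ e, 0 < ω e) → ∀ (u : Vertex d → ℝ) (n : ℕ), 1 ≤ n →
      IsHarmonicWithin ω (4 * n) u →
        sobolevNorm (gradExponent q) n (fun x => |u x|) (2 * n) ≤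
          C * √(ellipticity p q ω (box 0 (4 * n))) *
            avgNorm (2 * p.conjExponent) (box 0 (4 * n)) u := by
  have hT := two_le_toReal_two_mul_conjExponent hp
  have hT₀ := ENNReal.toReal_pos_iff.1 (zero_lt_two.trans_le hT)
  set r := gradExponent q
  have hr : 1 ≤ r := one_le_gradExponent hq
  set C₁ : ℝ := (d * 9 ^ d) ^ (q⁻¹).toReal * (3 * (d * 9 ^ d))
  set T := (2 * p.conjExponent).toReal
  set C₂ : ℝ := (9 ^ d) ^ ((1 - r / T) / r) * (9 ^ d) ^ (1 / T)
  refine ⟨√C₁ + C₂, by positivity, fun ω hω u n hn hu => ?_⟩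
  have hΛ : 1 ≤ ellipticity p q ω (box 0 (4 * n)) :=
    one_le_ellipticity hp.le hq hω (bondsIn_box_nonempty hd (by omega))
  set Λ := ellipticity p q ω (box 0 (4 * n)) with hΛ_def
  set U := avgNorm (2 * p.conjExponent) (box 0 (4 * n)) u
  have hU : 0 ≤ U := avgNorm_nonneg _ _ _
  have hgrad : gradNorm r n (fun x => |u x|) (2 * n) ≤ √C₁ * √Λ * U := by
    refine (pow_le_pow_iff_left₀ (gradNorm_nonneg _) (by positivity) two_ne_zero).1 ?_
    have hA := avgNorm_nonneg q (bondsIn (box (0 : Vertex d) (4 * n))) fun e => (ω e)⁻¹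
    refine (gradNorm_sq_le hq hω hn (by omega) _).trans <| (mul_le_mul_of_nonneg_left
      (energy_le_avgNorm hp hn hω hu) (by positivity)).trans_eq ?_
    rw [mul_pow, mul_pow, Real.sq_sqrt (by positivity), Real.sq_sqrt (by positivity), hΛ_def,
      ellipticity]
    ring
  have hbox : boxNorm r n (fun x => |u x|) (2 * n) ≤ C₂ * √Λ * U := calc
    _ = boxNorm r n u (2 * n) := by simp only [boxNorm, abs_abs]
    _ ≤ (9 ^ d) ^ ((1 - r / T) / r) * boxNorm T n u (2 * n) :=
      boxNorm_le_of_exponent_le _ (by positivity) ((gradExponent_le_two q).trans hT) hn (by omega)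
    _ ≤ (9 ^ d) ^ ((1 - r / T) / r) * ((9 ^ d) ^ (1 / T) * U) := by
      gcongr
      exact boxNorm_le_avgNorm u hT₀.1.ne' hT₀.2.ne hn (by omega)
    _ = C₂ * 1 * U := by ring
    _ ≤ C₂ * √Λ * U := by
      gcongr
      exact Real.one_le_sqrt.2 hΛ
  calc _ ≤ _ := sobolevNorm_le_add _ hn hr
    _ ≤ _ := add_le_add hgrad hbox
    _ = _ := by ring

/-! ### The iteration -/

section Recursion

variable {X : ℕ → ℝ} {B L U δ : ℝ} {K : ℕ}

-- The exponents of `B` and `L` solve the recursion with equality.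
theorem le_of_superlinear_recursion (hX : ∀ k, 0 ≤ X k) (hB : 0 < B) (hL : 0 < L) (hU : 0 ≤ U)
    (hδ : 0 < δ) (hzero : X 0 ≤ B * L * U)
    (hsucc : ∀ k < K, X (k + 1) ≤ B ^ (k + 1) * L * X k ^ (1 + δ)) :
    ∀ k ≤ K, X k ≤ B ^ ((1 + (1 + δ) / δ ^ 2) * (1 + δ) ^ k - (k / δ + (1 + δ) / δ ^ 2)) *
      L ^ (((1 + δ) * (1 + δ) ^ k - 1) / δ) * U ^ ((1 + δ) ^ k) := by
  intro k
  induction k with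
  | zero =>
    have hLexp : ((1 + δ) * (1 + δ) ^ 0 - 1) / δ = 1 := by
      field_simp
      ring
    rw [hLexp, pow_zero, Nat.cast_zero, zero_div, zero_add, mul_one, add_sub_cancel_right,
      Real.rpow_one, Real.rpow_one, Real.rpow_one]
    exact fun _ => hzero
  | succ k ih =>
    intro hk
    have hBexp : (1 + (1 + δ) / δ ^ 2) * (1 + δ) ^ (k + 1) -
        (((k + 1 : ℕ) : ℝ) / δ + (1 + δ) / δ ^ 2) = ((k + 1 : ℕ) : ℝ) +
          ((1 + (1 + δ) / δ ^ 2) * (1 + δ) ^ k - (k / δ + (1 + δ) / δ ^ 2)) * (1 + δ) := by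
      push_cast
      field_simp
      ring
    have hLexp : ((1 + δ) * (1 + δ) ^ (k + 1) - 1) / δ =
        1 + ((1 + δ) * (1 + δ) ^ k - 1) / δ * (1 + δ) := by
      field_simp
      ring
    refine (hsucc k hk).trans <| (mul_le_mul_of_nonneg_left (Real.rpow_le_rpow (hX k)
      (ih (Nat.le_of_succ_le hk)) (by positivity)) (by positivity)).trans_eq ?_
    rw [Real.mul_rpow (by positivity) (by positivity), Real.mul_rpow (by positivity)
      (by positivity), ← Real.rpow_mul hB.le, ← Real.rpow_mul hL.le, ← Real.rpow_mul hU, hBexp,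
      hLexp, Real.rpow_add hB, Real.rpow_add hL, Real.rpow_natCast, Real.rpow_one, pow_succ (1 + δ)]
    ring

theorem le_rpow_of_superlinear_recursion (hX : ∀ k, 0 ≤ X k) (hB : 1 ≤ B) (hL : 1 ≤ L)
    (hU : 0 ≤ U) (hδ : 0 < δ) (hzero : X 0 ≤ B * L * U)
    (hsucc : ∀ k < K, X (k + 1) ≤ B ^ (k + 1) * L * X k ^ (1 + δ)) :
    X K ≤ (B ^ (1 + (1 + δ) / δ ^ 2) * L ^ ((1 + δ) / δ) * U) ^ ((1 + δ) ^ K) := by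
  have hB₀ : 0 < B := by linarith
  have hL₀ : 0 < L := by linarith
  have hexp : ((1 + δ) * (1 + δ) ^ K - 1) / δ ≤ (1 + δ) / δ * (1 + δ) ^ K := by
    rw [div_mul_eq_mul_div]
    gcongr
    exact sub_le_self _ zero_le_one
  rw [Real.mul_rpow (by positivity) (by positivity), Real.mul_rpow (by positivity)
    (by positivity), ← Real.rpow_mul hB₀.le, ← Real.rpow_mul hL₀.le]
  refine (le_of_superlinear_recursion hX hB₀ hL₀ hU hδ hzero hsucc K le_rfl).trans ?_
  refine mul_le_mul_of_nonneg_right (mul_le_mul ?_ ?_ (by positivity) (by positivity))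
    (by positivity)
  · exact Real.rpow_le_rpow_of_exponent_le hB (sub_le_self _ (by positivity))
  · exact Real.rpow_le_rpow_of_exponent_le hL hexp

end Recursion

theorem div_two_pow_succ_lt {n k : ℕ} (hk : 2 ^ (k + 1) ≤ n) : n / 2 ^ (k + 1) < n / 2 ^ k := by
  have hpos : 0 < n / 2 ^ k :=
    Nat.div_pos ((Nat.pow_le_pow_right two_pos k.le_succ).trans hk) (by positivity)
  rw [pow_succ, ← Nat.div_div_eq_div_mul]
  omega

theorem div_radii_sub_le {n k : ℕ} (hk : 2 ^ (k + 1) ≤ n) :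
    (n : ℝ) / ((n + n / 2 ^ k : ℕ) - (n + n / 2 ^ (k + 1) : ℕ)) ≤ 4 * 2 ^ k := by
  have hlt := div_two_pow_succ_lt hk
  have : 2 ≤ n / 2 ^ k := by
    rwa [Nat.le_div_iff_mul_le (by positivity), ← pow_succ']
  have hhalf : n / 2 ^ (k + 1) = n / 2 ^ k / 2 := by rw [Nat.div_div_eq_div_mul, pow_succ]
  have hn : n ≤ 2 ^ k * (n / 2 ^ k + 1) := (Nat.lt_mul_div_succ n (by positivity)).le
  rw [div_le_iff₀ (sub_pos.2 (by exact_mod_cast Nat.add_lt_add_left hlt n)),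
    ← Nat.cast_sub (by omega), Nat.add_sub_add_left]
  have hfour : n / 2 ^ k + 1 ≤ 4 * (n / 2 ^ k - n / 2 ^ (k + 1)) := by omega
  have : n ≤ 4 * 2 ^ k * (n / 2 ^ k - n / 2 ^ (k + 1)) := calc
    n ≤ 2 ^ k * (4 * (n / 2 ^ k - n / 2 ^ (k + 1))) :=
      hn.trans (Nat.mul_le_mul_left _ hfour)
    _ = _ := by ring
  exact_mod_cast this

theorem natCast_pow_le_rpow {n d : ℕ} {δ : ℝ} (hδ : 0 < δ) (hδ₁ : δ ≤ 1) :
    (n : ℝ) ^ d ≤ ((2 : ℝ) ^ (d / δ)) ^ ((1 + δ) ^ Nat.log 2 n) := by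
  set K := Nat.log 2 n
  have hn : (n : ℝ) ≤ 2 ^ (K + 1) := by
    exact_mod_cast (Nat.lt_pow_succ_log_self one_lt_two n).le
  have hbernoulli : 1 + K * δ ≤ (1 + δ) ^ K := one_add_mul_le_pow (by linarith) K
  have hK : ((K : ℝ) + 1) * δ ≤ (1 + δ) ^ K := by linarith
  rw [← Real.rpow_mul two_pos.le]
  calc (n : ℝ) ^ d ≤ (2 ^ (K + 1)) ^ d := by gcongr
    _ = (2 : ℝ) ^ (d / δ * ((K + 1) * δ)) := by
      rw [← pow_mul, ← Real.rpow_natCast]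
      congr 1
      push_cast
      field_simp
    _ ≤ _ := by
      gcongr
      exact one_le_two

/-- The `k`-th norm of the iteration: the Sobolev norm of `|u| ^ ((1 + δ) ^ k)` on the box of
radius `n + n / 2 ^ k`, where `δ` is the gap. -/
noncomputable def moserNorm {d : ℕ} (p q : ℝ≥0∞) (n : ℕ) (u : Vertex d → ℝ) (k : ℕ) : ℝ :=
  sobolevNorm (gradExponent q) n (fun x => |u x| ^ ((1 + gap d p q) ^ k)) (n + n / 2 ^ k)

theorem moserNorm_nonneg {d : ℕ} (p q : ℝ≥0∞) (n : ℕ) (u : Vertex d → ℝ) (k : ℕ) :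
    0 ≤ moserNorm p q n u k :=
  sobolevNorm_nonneg _

section Iteration

variable {m : ℕ} {p q : ℝ≥0∞}

theorem gap_le_one (hm : 2 ≤ m) : gap (m + 1) p q ≤ 1 :=
  (gap_le_one_div m p q).trans <| div_le_one_of_le₀ (by exact_mod_cast (by omega : 1 ≤ m))
    m.cast_nonneg

theorem moserNorm_succ_le (hm : 2 ≤ m) (hp : 1 < p) (hq : 1 ≤ q) (hgap : 0 < gap (m + 1) p q) :
    ∃ C : ℝ, 0 ≤ C ∧ ∀ ω : Bond (m + 1) → ℝ, (∀ e, 0 < ω e) → ∀ (u : Vertex (m + 1) → ℝ) (n : ℕ),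
      1 ≤ n → IsHarmonicWithin ω (4 * n) u → ∀ k < Nat.log 2 n,
        moserNorm p q n u (k + 1) ≤
          C * 8 ^ k * √(ellipticity p q ω (box 0 (4 * n))) *
            moserNorm p q n u k ^ (1 + gap (m + 1) p q) := by
  obtain ⟨C, hC, hstep⟩ := sobolevNorm_step hm hp hq hgap
  refine ⟨C * 16, by positivity, fun ω hω u n hn hu k hk => ?_⟩
  have hkn : 2 ^ (k + 1) ≤ n := Nat.pow_le_of_le_log (by omega) hk
  have hlt := div_two_pow_succ_lt hkn
  have hdiv : n / 2 ^ k ≤ n := Nat.div_le_self _ _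
  have hX := moserNorm_nonneg p q n u k
  have h := hstep ω hω u ((1 + gap (m + 1) p q) ^ k) (one_le_pow₀ (by linarith)) n
    (n + n / 2 ^ (k + 1)) (n + n / 2 ^ k) hn (Nat.le_add_right _ _) (Nat.add_lt_add_left hlt n)
    (Nat.add_le_add (Nat.le_add_right _ _) hdiv) (by omega) (hu.mono (by omega))
  rw [← pow_succ] at h
  refine h.trans (mul_le_mul_of_nonneg_right ?_ (Real.rpow_nonneg hX _))
  have hsqrt : √((1 + gap (m + 1) p q) ^ k) ≤ 2 ^ k := by
    rw [Real.sqrt_le_left (by positivity), pow_right_comm]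
    exact pow_le_pow_left₀ (by linarith) (by linarith [gap_le_one (p := p) (q := q) hm]) k
  have hratio := div_radii_sub_le hkn
  have hratio₀ : (0 : ℝ) ≤ n / ((n + n / 2 ^ k : ℕ) - (n + n / 2 ^ (k + 1) : ℕ)) :=
    div_nonneg n.cast_nonneg (sub_nonneg.2 (by exact_mod_cast Nat.add_le_add_left hlt.le n))
  calc _ ≤ C * (2 ^ k * √(ellipticity p q ω (box 0 (4 * n))) * (4 * 2 ^ k) ^ 2) := by
        gcongr
    _ = C * 16 * (2 * 2 * 2) ^ k * √(ellipticity p q ω (box 0 (4 * n))) := by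
        simp only [mul_pow]
        ring
    _ = _ := by norm_num

theorem moserNorm_log_le (hm : 2 ≤ m) (hp : 1 < p) (hq : 1 ≤ q) (hgap : 0 < gap (m + 1) p q) :
    ∃ C : ℝ, 1 ≤ C ∧ ∀ ω : Bond (m + 1) → ℝ, (∀ e, 0 < ω e) → ∀ (u : Vertex (m + 1) → ℝ) (n : ℕ),
      1 ≤ n → IsHarmonicWithin ω (4 * n) u →
        moserNorm p q n u (Nat.log 2 n) ≤
          (C * ellipticity p q ω (box 0 (4 * n)) ^
            ((gap (m + 1) p q + 1) / (2 * gap (m + 1) p q)) *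
            avgNorm (2 * p.conjExponent) (box 0 (4 * n)) u) ^
          ((1 + gap (m + 1) p q) ^ Nat.log 2 n) := by
  obtain ⟨C₀, hC₀, hstart⟩ := sobolevNorm_start (d := m + 1) (by omega) hp hq
  obtain ⟨C₁, hC₁, hsucc⟩ := moserNorm_succ_le hm hp hq hgap
  set δ := gap (m + 1) p q
  set B : ℝ := 8 + C₀ + C₁
  have hB : 1 ≤ B := by simp only [B]; linarith
  refine ⟨B ^ (1 + (1 + δ) / δ ^ 2), Real.one_le_rpow hB (by positivity),
    fun ω hω u n hn hu => ?_⟩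
  have hΛ : 1 ≤ ellipticity p q ω (box 0 (4 * n)) :=
    one_le_ellipticity hp.le hq hω (bondsIn_box_nonempty (by omega) (by omega))
  set Λ := ellipticity p q ω (box 0 (4 * n))
  have hU := avgNorm_nonneg (2 * p.conjExponent) (box 0 (4 * n)) u
  have hsqrt : √Λ ^ ((1 + δ) / δ) = Λ ^ ((δ + 1) / (2 * δ)) := by
    rw [Real.sqrt_eq_rpow, ← Real.rpow_mul (zero_le_one.trans hΛ)]
    ring_nf
  rw [← hsqrt]
  refine le_rpow_of_superlinear_recursion (moserNorm_nonneg p q n u) hB (Real.one_le_sqrt.2 hΛ)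
    hU hgap ?_ fun k hk => (hsucc ω hω u n hn hu k hk).trans ?_
  · simp only [moserNorm, pow_zero, Real.rpow_one, Nat.div_one, ← two_mul]
    refine (hstart ω hω u n hn hu).trans ?_
    gcongr
    simp only [B]
    linarith
  · have hX := moserNorm_nonneg p q n u k
    rw [pow_succ']
    gcongr <;> simp only [B] <;> linarith

end Iteration

end RandomConductance

theorem theorem3p3_general {d : ℕ} (hd : 3 ≤ d) {p q : ℝ≥0∞} (hp : 1 < p) (hq : 1 < q)
    (hpq : (p⁻¹).toReal + (q⁻¹).toReal < 2 / ((d : ℝ) - 1)) :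
    0 < gap d p q ∧
    ∃ c : ℝ, 1 ≤ c ∧
      ∀ ω : Bond d → ℝ, (∀ e, 0 < ω e) → ∀ (u : Vertex d → ℝ) (n : ℕ), 1 ≤ n →
        IsHarmonicWithin ω (4 * n) u → ∀ x ∈ box (0 : Vertex d) n,
          |u x| ≤ c * ellipticity p q ω (box 0 (4 * n)) ^ ((gap d p q + 1) / (2 * gap d p q))
            * avgNorm (2 * p.conjExponent) (box 0 (4 * n)) u := by
  have hgap : 0 < gap d p q := by
    have hhalf : 1 / ((d : ℝ) - 1) = 2 / ((d : ℝ) - 1) / 2 := by ring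
    rw [gap, hhalf]
    linarith
  obtain ⟨m, rfl⟩ : ∃ m, d = m + 1 := ⟨d - 1, by omega⟩
  obtain ⟨C, hC, hiter⟩ := moserNorm_log_le (by omega) hp hq.le hgap
  set δ := gap (m + 1) p q
  refine ⟨hgap, 2 ^ (((m + 1 : ℕ) : ℝ) / δ) * C,
    one_le_mul_of_one_le_of_one_le (Real.one_le_rpow one_le_two (by positivity)) hC,
    fun ω hω u n hn hu x hx => ?_⟩
  have hχ : 0 < (1 + δ) ^ Nat.log 2 n := by positivity
  have hU := avgNorm_nonneg (2 * p.conjExponent) (box 0 (4 * n)) u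
  have hΛ : 0 ≤ ellipticity p q ω (box 0 (4 * n)) :=
    mul_nonneg (avgNorm_nonneg _ _ _) (avgNorm_nonneg _ _ _)
  refine (Real.rpow_le_rpow_iff (abs_nonneg _) (by positivity) hχ).1 ?_
  rw [mul_assoc (2 ^ _ * C), mul_assoc (2 ^ _), Real.mul_rpow (by positivity) (by positivity),
    ← mul_assoc C]
  calc |u x| ^ (1 + δ) ^ Nat.log 2 n
      ≤ (n : ℝ) ^ (m + 1) * moserNorm p q n u (Nat.log 2 n) :=
        (le_abs_self _).trans <| abs_le_pow_mul_sobolevNorm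
          (fun x => |u x| ^ (1 + δ) ^ Nat.log 2 n) hn (one_le_gradExponent hq.le)
          (box_zero_mono (Nat.le_add_right _ _) hx)
    _ ≤ _ :=
        mul_le_mul (natCast_pow_le_rpow hgap (gap_le_one (by omega))) (hiter ω hω u n hn hu)
          (moserNorm_nonneg _ _ _ _ _) (by positivity)

theorem theorem3p3 (d : ℕ) (hd : 3 ≤ d) (p q : ℝ≥0∞) (hp : 1 < p) (hq : 1 < q)
    (hpq : (p⁻¹).toReal + (q⁻¹).toReal < 2 / ((d : ℝ) - 1)) :
    0 < gap d p q ∧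
    ∃ c : ℝ, 1 ≤ c ∧
      ∀ ω : Bond d → ℝ, (∀ e, 0 < ω e) →
      ∀ u : Vertex d → ℝ, (∀ x, dvg (fun e => ω e * grad u e) x = 0) →
      ∀ n : ℕ, 1 ≤ n → ∀ x ∈ box (0 : Vertex d) n,
        |u x| ≤ c * ellipticity p q ω (box 0 (4 * n)) ^ ((gap d p q + 1) / (2 * gap d p q))
          * avgNorm (2 * p.conjExponent) (box 0 (4 * n)) u := by
  obtain ⟨hgap, c, hc, hbound⟩ := theorem3p3_general hd hp hq hpq
  exact ⟨hgap, c, hc, fun ω hω u hu n hn => hbound ω hω u n hn fun x _ => hu x⟩
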